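/- **Setting.** Let $d\in\mathbb N$, let $\mathcal A$ be a finite non-empty set of actions, $\gamma\in(0,1)$, $R_{\max}>0$, $C\in\mathbb R$ and $V_{\max}=R_{\max}/(1-\gamma)$. Consider discounted Markov decision processes with state space $\mathcal S=[0,1]^d$, action set $\mathcal A$, deterministic transitions $(s,a)\mapsto s\circ a$, and random rewards $\mathcal R(s,a)\in[-R_{\max},R_{\max}]$ (transitions and rewards depend measurably on $s$). The value of a stationary randomized policy is $V^\pi(s)=\mathbb E_\pi[\sum_{t\ge0}\gamma^t\mathcal R(s_t,a_t)\mid s_0=s]$, and $V^*=\sup_\pi V^\pi$. Assume $|V^*(s)-V^*(s')|\le C\|s-s'\|_2$ for all $s,s'\in\mathcal S$. **Tree search.** $\mathrm{MCTS}(\hat V,H,n,s)$ works on the tree of depth $H$ with root $s$; its nodes are the action sequences of length at most $H$, and every node carries the state that its sequence leads to. All visit counts $N$, cumulative edge rewards $q$ and cumulative node values $\tilde v$ start at $0$. Each of the $n$ simulations descends from the root to depth $H$, where at a node $p$ of depth $h$ it takes an action $a$ (ties broken by an arbitrary rule that may depend on the node and its visit count) that maximizes $$\frac{q(p,a)+\gamma\,\tilde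 v(pa)}{N(pa)}+\frac{(\beta^{(h+1)})^{1/\xi^{(h+1)}}\,N(p)^{\alpha^{(h+1)}/\xi^{(h+1)}}}{N(pa)^{1-\eta^{(h+1)}}}$$ ($+\infty$ if $N(pa)=0$), and receives a fresh independent sample $r^{(h+1)}$ of the reward. Then, along the path, every visit count increases by $1$, every edge value by the reward received on the edge, and the value of the node at depth $h\le H$ by $\sum_{i=h}^{H-1}\gamma^{i-h}r^{(i+1)}+\gamma^{H-h}\hat V(s^{(H)})$, where $s^{(H)}$ is the state of the leaf. The output is $\tilde v(\text{root})/n$. The constants are required to satisfy: $\eta^{(h)}=\eta\in[1/2,1)$, $\alpha^{(h)}=\eta(1-\eta)\xi^{(h)}$ and $\beta^{(h)}>1$ for $1\le h\le H$; $\xi^{(h)}=\alpha^{(h+1)}-1$ for $1\le h<H$; and $\alpha^{(1)}>2$. **Regression.** For $\delta\in(0,1)$ let $c_1,c_2,\dots$ be an arbitrary enumeration of the closed $\ell_2$-balls of radius $\delta$ whose centres have all coordinates in $\{\tfrac12\tau i\}\cup\{1-\tfrac12\tau i\}$, $0\le i\le\lfloor2/\tau\rfloor$ integer, where $\tau=\delta/\max(1,\sqrt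 d/4)$; they cover $[0,1]^d$. From data $(s_i,y_i)_{i\le m}$ the nearest neighbour estimate at $s$ is the average of the $y_i$ with $s_i\in c_{j(s)}$, where $j(s)=\min\{j:s\in c_j\}$, and $0$ if there are none. **Algorithm.** $V^{(0)}=0$. In round $\ell=1,\dots,L$ draw $m_\ell$ states $s_i$ independently and uniformly from $\mathcal S$, compute $\hat V^{(\ell)}(s_i)=\mathrm{MCTS}(V^{(\ell-1)},H^{(\ell)},n_\ell,s_i)$ with independent randomness, and let $V^{(\ell)}$ be the nearest neighbour estimate with radius $\delta_\ell\in(0,1)$ from the data $(s_i,\hat V^{(\ell)}(s_i))_{i\le m_\ell}$. **Theorem.** For every $\varepsilon>0$ one can choose $L$ and, for $1\le\ell\le L$, parameters $m_\ell\ge1$, $\delta_\ell\in(0,1)$, $H^{(\ell)}\ge1$, $n_\ell\ge1$ and tree search constants as above, all depending only on $\varepsilon,d,|\mathcal A|,\gamma,R_{\max},C$, such that for every process as above $$\mathbb E\Big[\sup_{s\in\mathcal S}\big|V^{(L)}(s)-V^*(s)\big|\Big]\le\varepsilon,$$ where, as $\varepsilon\to0$, $L=\Theta\big(|\log(\varepsilon/V_{\max})|\big)$,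 and the total number of state transitions made in all simulations of all rounds is at most $T(\varepsilon)=O\big(\varepsilon^{-(4+d)}(\log\tfrac1\varepsilon)^5\big)$; the constants in $\Theta$ and $O$ depend only on $d,|\mathcal A|,\gamma,R_{\max},C$. -/

import Mathlib

open MeasureTheory ProbabilityTheory Asymptotics Topology

noncomputable section

namespace MctsNN

/-! ### Markov decision processes on the unit cube -/

/-- The state space `[0,1]^d`. Its `volume` is the uniform distribution. -/
abbrev State (d : ℕ) : Type := Fin d → unitInterval

/-- The coordinates of a state, as real numbers. -/
def coords {d : ℕ} (s : State d) : Fin d → ℝ := fun k => (s k : ℝ)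

/-- The Euclidean (`ℓ₂`) distance on `ℝ^d`. -/
def l2dist {d : ℕ} (x y : Fin d → ℝ) : ℝ := √(∑ k, (x k - y k) ^ 2)

/-- A Markov decision process with state space `[0,1]^d`, action set `A` and deterministic
transitions. The random reward of the action `a` in the state `s` is the random variable
`reward s a` on the probability space `(Ξ, noise)`. -/
structure DetMDP (d : ℕ) (A Ξ : Type*) [MeasurableSpace Ξ] where
  /-- the state reached from a state by an action -/
  next : State d → A → State d
  measurable_next : ∀ a, Measurable fun s => next s a
  noise : Measure Ξ
  isProbabilityMeasure_noise : IsProbabilityMeasure noise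
  reward : State d → A → Ξ → ℝ
  measurable_reward : ∀ a, Measurable fun x : State d × Ξ => reward x.1 a x.2

section Value

variable {d : ℕ} {A Ξ : Type*} [Finite A] [MeasurableSpace A] [DiscreteMeasurableSpace A]
  [MeasurableSpace Ξ]

instance (M : DetMDP d A Ξ) : IsProbabilityMeasure M.noise := M.isProbabilityMeasure_noise

/-- One time step from the state `s` under the stationary randomized policy `π`: the law of
(state, action, reward noise), that is `δ_s ⊗ π(· | s) ⊗ noise`. -/
def DetMDP.stepKernel (M : DetMDP d A Ξ) (π : Kernel (State d) A) :
    Kernel (State d) (State d × A × Ξ) :=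
  Kernel.id ×ₖ (π ×ₖ Kernel.const (State d) M.noise)

instance (M : DetMDP d A Ξ) (π : Kernel (State d) A) [IsMarkovKernel π] :
    IsMarkovKernel (M.stepKernel π) := by
  unfold DetMDP.stepKernel; infer_instance

/-- The state that follows the last entry of a history. -/
def DetMDP.nextOfHistory (M : DetMDP d A Ξ) (n : ℕ)
    (h : (i : Finset.Iic n) → State d × A × Ξ) : State d :=
  M.next (h ⟨n, Finset.mem_Iic.2 le_rfl⟩).1 (h ⟨n, Finset.mem_Iic.2 le_rfl⟩).2.1

theorem DetMDP.measurable_nextOfHistory (M : DetMDP d A Ξ) (n : ℕ) :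
    Measurable (M.nextOfHistory n) := by
  have h1 : Measurable fun x : State d × A => M.next x.1 x.2 :=
    measurable_from_prod_countable_left M.measurable_next
  have h2 : Measurable fun h : (i : Finset.Iic n) → State d × A × Ξ =>
      h ⟨n, Finset.mem_Iic.2 le_rfl⟩ := measurable_pi_apply _
  exact h1.comp (h2.fst.prodMk h2.snd.fst)

/-- The law of the trajectory (state, action, reward noise) at times `0, 1, 2, …` that starts in
`s` and follows the policy `π`. -/
def DetMDP.trajectory (M : DetMDP d A Ξ) (π : Kernel (State d) A) [IsMarkovKernel π]
    (s : State d) : Measure (ℕ → State d × A × Ξ) :=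
  Kernel.trajMeasure (X := fun _ => State d × A × Ξ) (M.stepKernel π s)
    (fun n => (M.stepKernel π).comap (M.nextOfHistory n) (M.measurable_nextOfHistory n))

/-- The value `V^π(s)`: the expected discounted sum of rewards. -/
def DetMDP.policyValue (M : DetMDP d A Ξ) (γ : ℝ) (π : Kernel (State d) A) [IsMarkovKernel π]
    (s : State d) : ℝ :=
  ∫ x, ∑' t : ℕ, γ ^ t * M.reward (x t).1 (x t).2.1 (x t).2.2 ∂(M.trajectory π s)

/-- The optimal value function `V*(s) = sup_π V^π(s)`. -/
def DetMDP.optimalValue (M : DetMDP d A Ξ) (γ : ℝ) (s : State d) : ℝ :=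
  ⨆ π : {π : Kernel (State d) A // IsMarkovKernel π},
    haveI := π.2
    M.policyValue γ π.1 s

end Value

/-! ### Fixed-depth Monte Carlo tree search with a polynomial bonus -/

/-- The parameters of one call of tree search: the depth `H`, the number `n` of simulations, and
the constants `α⁽ʰ⁾, β⁽ʰ⁾, ξ⁽ʰ⁾, η⁽ʰ⁾` of the bonus term, `1 ≤ h ≤ H`. -/
structure TreeParams where
  depth : ℕ
  sims : ℕ
  α : ℕ → ℝ
  β : ℕ → ℝ
  ξ : ℕ → ℝ
  η : ℕ → ℝ

/-- The admissible parameters: one exponent `η ∈ [1/2, 1)` for all depths and recursively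
determined `α⁽ʰ⁾, ξ⁽ʰ⁾`, started from a `ξ⁽ᴴ⁾` that is so large that `α⁽¹⁾ > 2`. -/
structure TreeParams.Admissible (P : TreeParams) : Prop where
  depth_pos : 1 ≤ P.depth
  sims_pos : 1 ≤ P.sims
  eta : ∃ η : ℝ, 1 / 2 ≤ η ∧ η < 1 ∧ ∀ h ∈ Finset.Icc 1 P.depth, P.η h = η
  alpha : ∀ h ∈ Finset.Icc 1 P.depth, P.α h = P.η h * (1 - P.η h) * P.ξ h
  xi : ∀ h, 1 ≤ h → h < P.depth → P.ξ h = P.α (h + 1) - 1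
  alpha_one : 2 < P.α 1
  beta : ∀ h ∈ Finset.Icc 1 P.depth, 1 < P.β h

/-- The statistics of a search tree. A node at depth `h` is the list of the `h` actions that lead
to it from the root, the last action first; so the root is `[]`, and the child of the node `p`
under the action `a` is `a :: p`. A nonempty node also names the edge by which it is entered. -/
structure SearchTree (A : Type*) where
  /-- visit counts of the nodes -/
  visits : List A → ℕ
  /-- cumulative rewards of the edges -/
  edgeValue : List A → ℝ
  /-- cumulative values of the nodes -/
  nodeValue : List A → ℝ
  /-- number of state transitions made so far -/
  transitions : ℕ

/-- The tree before the first simulation. -/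
def SearchTree.empty (A : Type*) : SearchTree A := ⟨fun _ => 0, fun _ => 0, fun _ => 0, 0⟩

/-- A tie-breaking rule: at a given node, at a given number of visits of it, it picks one of the
maximizing actions. -/
abbrev TieRule (A : Type*) : Type _ := List A → ℕ → Finset A → A

/-- The picked action is one of the maximizers. -/
def TieRule.Valid {A : Type*} (tie : TieRule A) : Prop :=
  ∀ p k (s : Finset A), s.Nonempty → tie p k s ∈ s

section Search

variable {d : ℕ} {A Ξ : Type*} [Fintype A] [MeasurableSpace Ξ]

/-- The upper confidence index of the action `a` at the node `p`; it is `+∞` if the corresponding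
child has not been visited. -/
def SearchTree.index (P : TreeParams) (γ : ℝ) (T : SearchTree A) (p : List A) (a : A) : EReal :=
  if T.visits (a :: p) = 0 then ⊤
  else
    (((T.edgeValue (a :: p) + γ * T.nodeValue (a :: p)) / (T.visits (a :: p) : ℝ)
      + P.β (p.length + 1) ^ (1 / P.ξ (p.length + 1))
          * (T.visits p : ℝ) ^ (P.α (p.length + 1) / P.ξ (p.length + 1))
        / (T.visits (a :: p) : ℝ) ^ (1 - P.η (p.length + 1)) : ℝ) : EReal)

open Classical in
/-- The action selected at the node `p`: a maximizer of the index. -/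
def SearchTree.select (P : TreeParams) (γ : ℝ) (tie : TieRule A) (T : SearchTree A)
    (p : List A) : A :=
  tie p (T.visits p) (Finset.univ.filter fun a => ∀ b, T.index P γ p b ≤ T.index P γ p a)

/-- The node at depth `h` of the path that the next simulation follows. -/
def SearchTree.descend (P : TreeParams) (γ : ℝ) (tie : TieRule A) (T : SearchTree A) :
    ℕ → List A
  | 0 => []
  | h + 1 => T.select P γ tie (T.descend P γ tie h) :: T.descend P γ tie h

/-- The state at a node of the tree with root state `s`. -/
def DetMDP.nodeState (M : DetMDP d A Ξ) (s : State d) : List A → State d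
  | [] => s
  | a :: p => M.next (M.nodeState s p) a

/-- The reward received on an edge, from the value `ζ` of the noise (`0` for the root, which is not
entered by an edge). -/
def DetMDP.edgeReward (M : DetMDP d A Ξ) (s : State d) (ζ : Ξ) : List A → ℝ
  | [] => 0
  | a :: p => M.reward (M.nodeState s p) a ζ

open Classical in
/-- One simulation: follow the selected actions down to depth `H`, evaluate the leaf by the value
oracle `V`, and update the statistics of all nodes and edges on the path. The reward at the `j`-th
traversal of an edge `p` uses the noise `W p j`. -/
def SearchTree.simulate (M : DetMDP d A Ξ) (γ : ℝ) (P : TreeParams) (tie : TieRule A)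
    (V : State d → ℝ) (s : State d) (W : List A → ℕ → Ξ) (T : SearchTree A) : SearchTree A :=
  let node : ℕ → List A := T.descend P γ tie
  -- the reward `r⁽ʰ⁾` received on the edge that enters the node at depth `h`
  let r : ℕ → ℝ := fun h => M.edgeReward s (W (node h) (T.visits (node h))) (node h)
  -- the discounted return from depth `h` on
  let G : ℕ → ℝ := fun h =>
    ∑ i ∈ Finset.range (P.depth - h), γ ^ i * r (h + i + 1)
      + γ ^ (P.depth - h) * V (M.nodeState s (node P.depth))
  let onPath : List A → Prop := fun p => p.length ≤ P.depth ∧ p = node p.length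
  { visits := fun p => if onPath p then T.visits p + 1 else T.visits p
    edgeValue := fun p => if onPath p then T.edgeValue p + r p.length else T.edgeValue p
    nodeValue := fun p => if onPath p then T.nodeValue p + G p.length else T.nodeValue p
    transitions := T.transitions + (node P.depth).length }

/-- The search tree after all simulations. -/
def searchTree (M : DetMDP d A Ξ) (γ : ℝ) (P : TreeParams) (tie : TieRule A)
    (V : State d → ℝ) (s : State d) (W : List A → ℕ → Ξ) : SearchTree A :=
  (SearchTree.simulate M γ P tie V s W)^[P.sims] (SearchTree.empty A)

/-- The output of tree search: the average value at the root. -/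
def mcts (M : DetMDP d A Ξ) (γ : ℝ) (P : TreeParams) (tie : TieRule A)
    (V : State d → ℝ) (s : State d) (W : List A → ℕ → Ξ) : ℝ :=
  (searchTree M γ P tie V s W).nodeValue [] / (P.sims : ℝ)

end Search

/-! ### Nearest neighbour regression over a cover of the cube by balls -/

/-- The mesh of the grid of centres: `δ` in dimension `d ≤ 16` and `4 δ / √d` in higher dimension
(where a grid with mesh `δ` would not give a cover by balls of radius `δ`). -/
def gridMesh (d : ℕ) (δ : ℝ) : ℝ := δ / max 1 (√(d : ℝ) / 4)

/-- `{i τ / 2} ∪ {1 - i τ / 2}` for integers `0 ≤ i ≤ ⌊2 / τ⌋`. -/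
def gridCoords (τ : ℝ) : Set ℝ :=
  {x | ∃ i : ℕ, i ≤ ⌊2 / τ⌋₊ ∧ (x = 1 / 2 * τ * i ∨ x = 1 - 1 / 2 * τ * i)}

/-- The centres of the balls of radius `δ`. -/
def gridCenters (d : ℕ) (δ : ℝ) : Set (Fin d → ℝ) :=
  {c | ∀ k, c k ∈ gridCoords (gridMesh d δ)}

open Classical in
/-- The estimate at the state `s` from the data `(x i, y i)`: the average of the observations in
the first ball of the list that contains `s`, and `0` if there are none. -/
def nearestNeighbor {d m : ℕ} (centers : List (Fin d → ℝ)) (δ : ℝ) (x : Fin m → State d)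
    (y : Fin m → ℝ) (s : State d) : ℝ :=
  match centers.find? (fun c => decide (l2dist c (coords s) ≤ δ)) with
  | none => 0
  | some c =>
    let I : Finset (Fin m) := Finset.univ.filter fun i => l2dist c (coords (x i)) ≤ δ
    if I = ∅ then 0 else (∑ i ∈ I, y i) / (I.card : ℝ)

/-! ### The reinforcement learning algorithm -/

/-- All parameters: the number `L` of rounds and, for the rounds `1 ≤ ℓ ≤ L`, the number of sampled
states, the radius of the balls, and the parameters of tree search. -/
structure Params where
  rounds : ℕ
  samples : ℕ → ℕ
  radius : ℕ → ℝ
  tree : ℕ → TreeParams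

/-- Admissible parameters. -/
def Params.Admissible (P : Params) : Prop :=
  ∀ l ∈ Finset.Icc 1 P.rounds,
    1 ≤ P.samples l ∧ 0 < P.radius l ∧ P.radius l < 1 ∧ (P.tree l).Admissible

section Learning

variable {d : ℕ} {A Ξ : Type*} [MeasurableSpace Ξ]

/-- The randomness of one call of tree search: the sampled root state, and the noise of the `j`-th
traversal of each edge. -/
abbrev Seed (d : ℕ) (A Ξ : Type*) : Type _ := State d × (List A × ℕ → Ξ)

/-- The root state is uniform, all noise variables have the law of the reward noise, and everything
is independent. -/
def DetMDP.seedLaw (M : DetMDP d A Ξ) : Measure (Seed d A Ξ) :=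
  (volume : Measure (State d)).prod (Measure.infinitePi fun _ : List A × ℕ => M.noise)

instance (M : DetMDP d A Ξ) : IsProbabilityMeasure M.seedLaw := by
  unfold DetMDP.seedLaw; infer_instance

/-- The randomness of the algorithm: an independent seed for the `i`-th sampled state of each round
`ℓ`. -/
def DetMDP.sampleLaw (M : DetMDP d A Ξ) : Measure (ℕ → ℕ → Seed d A Ξ) :=
  Measure.infinitePi fun _ : ℕ => Measure.infinitePi fun _ : ℕ => M.seedLaw

variable [Fintype A]

/-- The estimate `V⁽ˡ⁾` after `l` rounds, started with `V⁽⁰⁾ = 0`. In each round, tree search with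
the previous estimate as value oracle is run on the sampled states, and its outputs are the
observations of nearest neighbour regression. The list `order δ` enumerates the balls of radius
`δ`. -/
def valueEstimate (M : DetMDP d A Ξ) (γ : ℝ) (P : Params) (tie : TieRule A)
    (order : ℝ → List (Fin d → ℝ)) (ω : ℕ → ℕ → Seed d A Ξ) : ℕ → State d → ℝ
  | 0 => fun _ => 0
  | l + 1 =>
    nearestNeighbor (m := P.samples (l + 1)) (order (P.radius (l + 1))) (P.radius (l + 1))
      (fun i => (ω (l + 1) i).1)
      (fun i => mcts M γ (P.tree (l + 1)) tie (valueEstimate M γ P tie order ω l)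
        (ω (l + 1) i).1 (fun p j => (ω (l + 1) i).2 (p, j)))

/-- The total number of state transitions in all simulations of all rounds. -/
def totalTransitions (M : DetMDP d A Ξ) (γ : ℝ) (P : Params) (tie : TieRule A)
    (order : ℝ → List (Fin d → ℝ)) (ω : ℕ → ℕ → Seed d A Ξ) : ℕ :=
  ∑ l ∈ Finset.range P.rounds, ∑ i : Fin (P.samples (l + 1)),
    (searchTree M γ (P.tree (l + 1)) tie (valueEstimate M γ P tie order ω l)
      (ω (l + 1) i).1 (fun p j => (ω (l + 1) i).2 (p, j))).transitions

end Learning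

end MctsNN

end

set_option linter.unusedSectionVars false

/-! All rounds use the same parameters, with a fixed depth `H` such that `γ ^ H ≤ 1/2`. Ideal
lookahead with oracle `V` is `H` applications of the Bellman operator, and it at least halves the
distance to the optimal value. If search and regression add at most `e` per round, the error after
`L` rounds is at most `Vmax / 2 ^ L + 2 * e`, so `L` of order `log (1/ε)` suffices
(`abs_valueEstimate_sub_le`).

Tree search is analysed pathwise. The noise of the `j`-th traversal of each edge is fixed
beforehand, so the cumulative reward of an edge visited `k` times is the `k`-th partial sum of a
sequence that does not depend on the search. Once all these sums for `k ≤ n` are within `c * k ^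
(3/4)` of their means (`Concentrated`), no probability remains. With `η = 1/2` and bonus `c * K ^ j
* N(p) ^ (1/4) / N(pa) ^ (1/2)`, where the children have remaining depth `j`, two inductions
interlock: one over the simulations (`LowRegret.simulate`) and one over the remaining depth
(`abs_nodeValue_sub_le`). They show that a node with remaining depth `j` and `N` visits has total
value within `c * K ^ j * N ^ (3/4)` of `N` times the ideal value. At the root this is an error `c *
K ^ H * n ^ (-1/4)` (`abs_mcts_sub_le`).

Hoeffding's inequality and a union bound over rounds, samples, nodes and counts make failure
polynomially unlikely already for `c` of order `√(log (1/ε))`. Likewise `ε ^ (-d) * log (1/ε)`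
uniform samples hit all balls of radius of order `ε`, and the Lipschitz assumption bounds the bias
of the regression. On the bad event the error is at most `2 * Vmax`. With `n` of order `(c/ε) ^ 4`,
the cost is of order `ε ^ (-(4+d)) * log (1/ε) ^ 4`, one logarithm better than needed
(`exists_suffices`).

The supremum over policies enters only through its distance to the iterates of the Bellman operator
on `0` (`abs_optimalValue_sub_iterate_le`). -/

noncomputable section

namespace MctsNN

section Tree

variable {d : ℕ} {A Ξ : Type*} [MeasurableSpace Ξ]

/-! ### The Bellman operator -/

/-- The expected reward of an action in a state. -/
def DetMDP.meanReward (M : DetMDP d A Ξ) (s : State d) (a : A) : ℝ :=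
  ∫ ζ, M.reward s a ζ ∂M.noise

/-- The expected reward on an edge of the tree with root state `s`. -/
def DetMDP.edgeMean (M : DetMDP d A Ξ) (s : State d) : List A → ℝ
  | [] => 0
  | a :: p => M.meanReward (M.nodeState s p) a

section Bellman

variable [Fintype A] [Nonempty A]

/-- The Bellman optimality operator. -/
def DetMDP.bellman (M : DetMDP d A Ξ) (γ : ℝ) (V : State d → ℝ) (s : State d) : ℝ :=
  Finset.univ.sup' Finset.univ_nonempty fun a => M.meanReward s a + γ * V (M.next s a)

theorem DetMDP.le_bellman (M : DetMDP d A Ξ) (γ : ℝ) (V : State d → ℝ) (s : State d) (a : A) :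
    M.meanReward s a + γ * V (M.next s a) ≤ M.bellman γ V s :=
  Finset.le_sup' (fun a => M.meanReward s a + γ * V (M.next s a)) (Finset.mem_univ a)

theorem DetMDP.exists_bellman_eq (M : DetMDP d A Ξ) (γ : ℝ) (V : State d → ℝ) (s : State d) :
    ∃ a, M.bellman γ V s = M.meanReward s a + γ * V (M.next s a) := by
  obtain ⟨a, -, ha⟩ := Finset.exists_mem_eq_sup' (Finset.univ_nonempty (α := A))
    (fun a => M.meanReward s a + γ * V (M.next s a))
  exact ⟨a, ha⟩

theorem DetMDP.abs_bellman_sub_bellman_le (M : DetMDP d A Ξ) {γ : ℝ} (hγ : 0 ≤ γ)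
    {V V' : State d → ℝ} {b : ℝ} (h : ∀ s, |V s - V' s| ≤ b) (s : State d) :
    |M.bellman γ V s - M.bellman γ V' s| ≤ γ * b := by
  have key : ∀ {V V' : State d → ℝ}, (∀ s, |V s - V' s| ≤ b) →
      M.bellman γ V s - M.bellman γ V' s ≤ γ * b := by
    intro V V' h
    obtain ⟨a, ha⟩ := M.exists_bellman_eq γ V s
    have h1 := M.le_bellman γ V' s a
    have h2 := mul_le_mul_of_nonneg_left (abs_le.1 (h (M.next s a))).2 hγ
    rw [ha]
    linarith
  rw [abs_le]
  have h1 := key h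
  have h2 := key (V := V') (V' := V) fun s => by rw [abs_sub_comm]; exact h s
  constructor <;> linarith

theorem DetMDP.abs_iterate_bellman_sub_le (M : DetMDP d A Ξ) {γ : ℝ} (hγ : 0 ≤ γ)
    {V V' : State d → ℝ} {b : ℝ} (h : ∀ s, |V s - V' s| ≤ b) (k : ℕ) (s : State d) :
    |(M.bellman γ)^[k] V s - (M.bellman γ)^[k] V' s| ≤ γ ^ k * b := by
  induction k generalizing s with
  | zero => simpa using h s
  | succ k ih =>
    rw [Function.iterate_succ_apply', Function.iterate_succ_apply', pow_succ', mul_assoc]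
    exact M.abs_bellman_sub_bellman_le hγ ih s

variable {R γ : ℝ}

theorem DetMDP.abs_meanReward_le (M : DetMDP d A Ξ) (hM : ∀ s a ζ, |M.reward s a ζ| ≤ R)
    (s : State d) (a : A) : |M.meanReward s a| ≤ R := by
  have h := norm_integral_le_of_norm_le_const (μ := M.noise) (f := M.reward s a) (C := R)
    (Filter.Eventually.of_forall fun ζ => by simpa using hM s a ζ)
  simpa [DetMDP.meanReward] using h

/-- Adding a reward after discounting preserves the bound `R / (1 - γ)`; the a priori bounds on
values and returns rest on this. -/
theorem add_mul_div_one_sub (hγ1 : γ < 1) : R + γ * (R / (1 - γ)) = R / (1 - γ) := by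
  have : 1 - γ ≠ 0 := by linarith
  field_simp
  ring

theorem DetMDP.abs_bellman_le (M : DetMDP d A Ξ) (hM : ∀ s a ζ, |M.reward s a ζ| ≤ R)
    (hγ : 0 ≤ γ) (hγ1 : γ < 1) {V : State d → ℝ} (hV : ∀ s, |V s| ≤ R / (1 - γ)) (s : State d) :
    |M.bellman γ V s| ≤ R / (1 - γ) := by
  obtain ⟨a, ha⟩ := M.exists_bellman_eq γ V s
  rw [ha, ← add_mul_div_one_sub hγ1]
  refine (abs_add_le _ _).trans (add_le_add (M.abs_meanReward_le hM s a) ?_)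
  rw [abs_mul, abs_of_nonneg hγ]
  exact mul_le_mul_of_nonneg_left (hV _) hγ

theorem DetMDP.abs_iterate_bellman_le (M : DetMDP d A Ξ) (hM : ∀ s a ζ, |M.reward s a ζ| ≤ R)
    (hγ : 0 ≤ γ) (hγ1 : γ < 1) {V : State d → ℝ} (hV : ∀ s, |V s| ≤ R / (1 - γ)) (k : ℕ)
    (s : State d) : |(M.bellman γ)^[k] V s| ≤ R / (1 - γ) := by
  induction k generalizing s with
  | zero => exact hV s
  | succ k ih =>
    rw [Function.iterate_succ_apply']
    exact M.abs_bellman_le hM hγ hγ1 ih s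

end Bellman

/-! ### One simulation -/

section Search

variable [Fintype A]

/-- The node lies on the path of the next simulation. -/
def SearchTree.OnPath (P : TreeParams) (γ : ℝ) (tie : TieRule A) (T : SearchTree A)
    (p : List A) : Prop :=
  p.length ≤ P.depth ∧ p = T.descend P γ tie p.length

/-- The reward that the next simulation receives on the edge into the node at depth `h`. -/
def SearchTree.nextReward (M : DetMDP d A Ξ) (γ : ℝ) (P : TreeParams) (tie : TieRule A)
    (s : State d) (W : List A → ℕ → Ξ) (T : SearchTree A) (h : ℕ) : ℝ :=
  M.edgeReward s (W (T.descend P γ tie h) (T.visits (T.descend P γ tie h))) (T.descend P γ tie h)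

/-- The discounted return of the next simulation from depth `h` on. -/
def SearchTree.nextReturn (M : DetMDP d A Ξ) (γ : ℝ) (P : TreeParams) (tie : TieRule A)
    (V : State d → ℝ) (s : State d) (W : List A → ℕ → Ξ) (T : SearchTree A) (h : ℕ) : ℝ :=
  ∑ i ∈ Finset.range (P.depth - h), γ ^ i * T.nextReward M γ P tie s W (h + i + 1)
    + γ ^ (P.depth - h) * V (M.nodeState s (T.descend P γ tie P.depth))

@[simp]
theorem SearchTree.length_descend (P : TreeParams) (γ : ℝ) (tie : TieRule A) (T : SearchTree A)
    (h : ℕ) : (T.descend P γ tie h).length = h := by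
  induction h with
  | zero => rfl
  | succ h ih => simp [SearchTree.descend, ih]

theorem SearchTree.onPath_nil (P : TreeParams) (γ : ℝ) (tie : TieRule A) (T : SearchTree A) :
    T.OnPath P γ tie [] := ⟨by simp, rfl⟩

theorem SearchTree.onPath_cons_iff {P : TreeParams} {γ : ℝ} {tie : TieRule A} {T : SearchTree A}
    {p : List A} (hp : p.length < P.depth) (a : A) :
    T.OnPath P γ tie (a :: p) ↔ T.OnPath P γ tie p ∧ a = T.select P γ tie p := by
  unfold SearchTree.OnPath
  simp only [List.length_cons, SearchTree.descend, List.cons.injEq]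
  constructor
  · rintro ⟨-, h1, h2⟩
    rw [← h2] at h1
    exact ⟨⟨hp.le, h2⟩, h1⟩
  · rintro ⟨⟨-, h2⟩, h1⟩
    rw [← h2]
    exact ⟨hp, h1, rfl⟩

variable {M : DetMDP d A Ξ} {γ : ℝ} {P : TreeParams} {tie : TieRule A} {V : State d → ℝ}
  {s : State d} {W : List A → ℕ → Ξ} {T : SearchTree A} {p : List A}

theorem SearchTree.visits_simulate (h : T.OnPath P γ tie p) :
    (T.simulate M γ P tie V s W).visits p = T.visits p + 1 :=
  if_pos h

theorem SearchTree.visits_simulate' (h : ¬ T.OnPath P γ tie p) :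
    (T.simulate M γ P tie V s W).visits p = T.visits p :=
  if_neg h

theorem SearchTree.edgeValue_simulate (h : T.OnPath P γ tie p) :
    (T.simulate M γ P tie V s W).edgeValue p
      = T.edgeValue p + T.nextReward M γ P tie s W p.length :=
  if_pos h

theorem SearchTree.edgeValue_simulate' (h : ¬ T.OnPath P γ tie p) :
    (T.simulate M γ P tie V s W).edgeValue p = T.edgeValue p :=
  if_neg h

theorem SearchTree.nodeValue_simulate (h : T.OnPath P γ tie p) :
    (T.simulate M γ P tie V s W).nodeValue p
      = T.nodeValue p + T.nextReturn M γ P tie V s W p.length :=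
  if_pos h

theorem SearchTree.nodeValue_simulate' (h : ¬ T.OnPath P γ tie p) :
    (T.simulate M γ P tie V s W).nodeValue p = T.nodeValue p :=
  if_neg h

theorem SearchTree.transitions_simulate :
    (T.simulate M γ P tie V s W).transitions = T.transitions + P.depth := by
  simp [SearchTree.simulate]

theorem SearchTree.nextReturn_eq {h : ℕ} (hh : h < P.depth) :
    T.nextReturn M γ P tie V s W h
      = T.nextReward M γ P tie s W (h + 1) + γ * T.nextReturn M γ P tie V s W (h + 1) := by
  obtain ⟨k, hk⟩ := Nat.exists_eq_add_of_lt hh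
  have h1 : P.depth - h = k + 1 := by omega
  have h2 : P.depth - (h + 1) = k := by omega
  unfold SearchTree.nextReturn
  rw [h1, h2, Finset.sum_range_succ', mul_add, Finset.mul_sum]
  have h3 : ∀ i, h + (i + 1) + 1 = h + 1 + i + 1 := fun i => by ring
  simp only [h3, pow_succ', pow_zero, one_mul, add_zero, mul_assoc]
  ring

theorem SearchTree.nextReward_of_onPath (h : T.OnPath P γ tie p) :
    T.nextReward M γ P tie s W p.length = M.edgeReward s (W p (T.visits p)) p := by
  unfold SearchTree.nextReward
  rw [← h.2]

theorem DetMDP.abs_edgeReward_le {R : ℝ} (hR : 0 ≤ R) (hM : ∀ s a ζ, |M.reward s a ζ| ≤ R)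
    (ζ : Ξ) : |M.edgeReward s ζ p| ≤ R := by
  cases p with
  | nil => simpa [DetMDP.edgeReward] using hR
  | cons a p => exact hM _ _ _

theorem SearchTree.abs_nextReturn_le {R : ℝ} (hR : 0 ≤ R) (hγ : 0 ≤ γ) (hγ1 : γ < 1)
    (hM : ∀ s a ζ, |M.reward s a ζ| ≤ R) (hV : ∀ s, |V s| ≤ R / (1 - γ)) {h : ℕ}
    (hh : h ≤ P.depth) : |T.nextReturn M γ P tie V s W h| ≤ R / (1 - γ) := by
  induction hh using Nat.decreasingInduction with
  | self => simpa [SearchTree.nextReturn] using hV _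
  | of_succ k hk ih =>
    rw [SearchTree.nextReturn_eq hk, ← add_mul_div_one_sub hγ1]
    refine (abs_add_le _ _).trans (add_le_add (DetMDP.abs_edgeReward_le hR hM _) ?_)
    rw [abs_mul, abs_of_nonneg hγ]
    exact mul_le_mul_of_nonneg_left ih hγ

/-! ### Invariants of the search tree -/

/-- The cumulative value of the child that is entered by the edge `p`, as seen from its parent. -/
def SearchTree.edgeReturn (γ : ℝ) (T : SearchTree A) (p : List A) : ℝ :=
  T.edgeValue p + γ * T.nodeValue p

variable (M γ P V s W) in
/-- The statistics of the tree fit together. -/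
structure SearchTree.Consistent (T : SearchTree A) : Prop where
  visits_eq : ∀ p : List A, p.length < P.depth → T.visits p = ∑ a, T.visits (a :: p)
  nodeValue_eq : ∀ p : List A, p.length < P.depth →
    T.nodeValue p = ∑ a, T.edgeReturn γ (a :: p)
  nodeValue_leaf : ∀ p : List A, p.length = P.depth →
    T.nodeValue p = T.visits p * V (M.nodeState s p)
  -- The adaptively collected rewards form a partial sum of a sequence fixed in advance, so that
  -- concentration can be stated without reference to the search.
  edgeValue_eq : ∀ p : List A, p.length ≤ P.depth →
    T.edgeValue p = ∑ j ∈ Finset.range (T.visits p), M.edgeReward s (W p j) p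

theorem SearchTree.consistent_empty : (SearchTree.empty A).Consistent M γ P V s W := by
  constructor <;> intros <;> simp [SearchTree.empty, SearchTree.edgeReturn]

/-- The reward on the edge plus `γ` times the return below it is the return seen from the parent, at
depth `p.length - 1`. Hence the edge returns of the children add up to the value of their parent. -/
theorem SearchTree.edgeReturn_simulate (hp : p ≠ []) (h : T.OnPath P γ tie p) :
    (T.simulate M γ P tie V s W).edgeReturn γ p
      = T.edgeReturn γ p + T.nextReturn M γ P tie V s W (p.length - 1) := by
  have h1 : 0 < p.length := List.length_pos_iff.2 hp
  have h2 := h.1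
  rw [SearchTree.nextReturn_eq (by omega), Nat.sub_add_cancel h1]
  unfold SearchTree.edgeReturn
  rw [SearchTree.edgeValue_simulate h, SearchTree.nodeValue_simulate h]
  ring

theorem SearchTree.edgeReturn_simulate' (h : ¬ T.OnPath P γ tie p) :
    (T.simulate M γ P tie V s W).edgeReturn γ p = T.edgeReturn γ p := by
  unfold SearchTree.edgeReturn
  rw [SearchTree.edgeValue_simulate' h, SearchTree.nodeValue_simulate' h]

/-- At an inner node on the path exactly one child is updated, the selected one, and off the path
nothing changes; so each sum over children changes by the same amount as the entry of the parent. -/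
theorem SearchTree.Consistent.simulate (hT : T.Consistent M γ P V s W) :
    (T.simulate M γ P tie V s W).Consistent M γ P V s W := by
  classical
  constructor
  · intro p hp
    by_cases h : T.OnPath P γ tie p
    · have h1 : ∀ a, (T.simulate M γ P tie V s W).visits (a :: p)
          = T.visits (a :: p) + if a = T.select P γ tie p then 1 else 0 := fun a => by
        by_cases ha : a = T.select P γ tie p
        · rw [SearchTree.visits_simulate ((SearchTree.onPath_cons_iff hp a).2 ⟨h, ha⟩), if_pos ha]
        · rw [SearchTree.visits_simulate' fun h' => ha ((SearchTree.onPath_cons_iff hp a).1 h').2,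
            if_neg ha, add_zero]
      simp only [h1, Finset.sum_add_distrib, Finset.sum_ite_eq', Finset.mem_univ, if_true]
      rw [SearchTree.visits_simulate h, hT.visits_eq p hp]
    · rw [SearchTree.visits_simulate' h, hT.visits_eq p hp]
      refine Finset.sum_congr rfl fun a _ => ?_
      rw [SearchTree.visits_simulate' fun h' => h ((SearchTree.onPath_cons_iff hp a).1 h').1]
  · intro p hp
    by_cases h : T.OnPath P γ tie p
    · have h1 : ∀ a, (T.simulate M γ P tie V s W).edgeReturn γ (a :: p)
          = T.edgeReturn γ (a :: p)
            + if a = T.select P γ tie p then T.nextReturn M γ P tie V s W p.length else 0 := by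
        intro a
        by_cases ha : a = T.select P γ tie p
        · rw [SearchTree.edgeReturn_simulate (by simp)
            ((SearchTree.onPath_cons_iff hp a).2 ⟨h, ha⟩), if_pos ha]
          simp
        · rw [SearchTree.edgeReturn_simulate' fun h' =>
              ha ((SearchTree.onPath_cons_iff hp a).1 h').2, if_neg ha, add_zero]
      simp only [h1, Finset.sum_add_distrib, Finset.sum_ite_eq', Finset.mem_univ, if_true]
      rw [SearchTree.nodeValue_simulate h, hT.nodeValue_eq p hp]
    · rw [SearchTree.nodeValue_simulate' h, hT.nodeValue_eq p hp]
      refine Finset.sum_congr rfl fun a _ => ?_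
      rw [SearchTree.edgeReturn_simulate' fun h' => h ((SearchTree.onPath_cons_iff hp a).1 h').1]
  · intro p hp
    by_cases h : T.OnPath P γ tie p
    · rw [SearchTree.nodeValue_simulate h, SearchTree.visits_simulate h, hT.nodeValue_leaf p hp,
        hp]
      have h2 := h.2
      rw [hp] at h2
      simp [SearchTree.nextReturn, ← h2]
      ring
    · rw [SearchTree.nodeValue_simulate' h, SearchTree.visits_simulate' h, hT.nodeValue_leaf p hp]
  · intro p hp
    by_cases h : T.OnPath P γ tie p
    · rw [SearchTree.edgeValue_simulate h, SearchTree.visits_simulate h, hT.edgeValue_eq p hp,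
        Finset.sum_range_succ, SearchTree.nextReward_of_onPath h]
    · rw [SearchTree.edgeValue_simulate' h, SearchTree.visits_simulate' h, hT.edgeValue_eq p hp]

theorem SearchTree.consistent_iterate (k : ℕ) :
    ((SearchTree.simulate M γ P tie V s W)^[k] (SearchTree.empty A)).Consistent M γ P V s W := by
  induction k with
  | zero => exact SearchTree.consistent_empty
  | succ k ih =>
    rw [Function.iterate_succ_apply']
    exact ih.simulate

theorem SearchTree.visits_iterate_nil (k : ℕ) :
    ((SearchTree.simulate M γ P tie V s W)^[k] (SearchTree.empty A)).visits [] = k := by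
  induction k with
  | zero => rfl
  | succ k ih =>
    rw [Function.iterate_succ_apply', SearchTree.visits_simulate (SearchTree.onPath_nil ..), ih]

theorem SearchTree.transitions_iterate (k : ℕ) :
    ((SearchTree.simulate M γ P tie V s W)^[k] (SearchTree.empty A)).transitions
      = k * P.depth := by
  induction k with
  | zero => simp [SearchTree.empty]
  | succ k ih =>
    rw [Function.iterate_succ_apply', SearchTree.transitions_simulate, ih, add_mul, one_mul]

theorem SearchTree.abs_nodeValue_iterate_nil_le {R : ℝ} (hR : 0 ≤ R) (hγ : 0 ≤ γ) (hγ1 : γ < 1)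
    (hM : ∀ s a ζ, |M.reward s a ζ| ≤ R) (hV : ∀ s, |V s| ≤ R / (1 - γ)) (k : ℕ) :
    |((SearchTree.simulate M γ P tie V s W)^[k] (SearchTree.empty A)).nodeValue []|
      ≤ k * (R / (1 - γ)) := by
  induction k with
  | zero => simp [SearchTree.empty]
  | succ k ih =>
    rw [Function.iterate_succ_apply', SearchTree.nodeValue_simulate (SearchTree.onPath_nil ..)]
    refine (abs_add_le _ _).trans ?_
    have := SearchTree.abs_nextReturn_le (T := (SearchTree.simulate M γ P tie V s W)^[k]
      (SearchTree.empty A)) (P := P) (tie := tie) (s := s) (W := W) hR hγ hγ1 hM hV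
      (Nat.zero_le P.depth)
    push_cast
    simp only [List.length_nil]
    linarith

theorem abs_mcts_le {R : ℝ} (hR : 0 ≤ R) (hγ : 0 ≤ γ) (hγ1 : γ < 1)
    (hM : ∀ s a ζ, |M.reward s a ζ| ≤ R) (hV : ∀ s, |V s| ≤ R / (1 - γ)) :
    |mcts M γ P tie V s W| ≤ R / (1 - γ) := by
  have h0 : 0 ≤ R / (1 - γ) := div_nonneg hR (by linarith)
  unfold mcts searchTree
  rw [abs_div, Nat.abs_cast]
  refine div_le_of_le_mul₀ (by positivity) h0 ?_
  rw [mul_comm]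
  exact SearchTree.abs_nodeValue_iterate_nil_le hR hγ hγ1 hM hV _

theorem transitions_searchTree :
    (searchTree M γ P tie V s W).transitions = P.sims * P.depth :=
  SearchTree.transitions_iterate _

end Search

end Tree

/-! ### Tree search with concentrated rewards -/

section Concentration

variable {d : ℕ} {A Ξ : Type*} [MeasurableSpace Ξ] [Fintype A] [Nonempty A]

/-- On every edge of the tree of depth `H` with root `s`, the sums of the first at most `n` rewards
are close to their expectations. -/
def DetMDP.Concentrated (M : DetMDP d A Ξ) (H n : ℕ) (c : ℝ) (s : State d)
    (W : List A → ℕ → Ξ) : Prop :=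
  ∀ p : List A, p.length ≤ H → ∀ k ≤ n,
    |∑ j ∈ Finset.range k, M.edgeReward s (W p j) p - k * M.edgeMean s p|
      ≤ c * (k : ℝ) ^ (3 / 4 : ℝ)

/-- The bonus at depth `h` is `B h * N(p) ^ (1/4) / N(pa) ^ (1/2)`. -/
structure TreeParams.HasBonus (P : TreeParams) (B : ℕ → ℝ) : Prop where
  β_rpow : ∀ h ∈ Finset.Icc 1 P.depth, P.β h ^ (1 / P.ξ h) = B h
  α_div : ∀ h ∈ Finset.Icc 1 P.depth, P.α h / P.ξ h = 1 / 4
  one_sub_η : ∀ h ∈ Finset.Icc 1 P.depth, 1 - P.η h = 1 / 2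

theorem rpow_quarter_mul_rpow_half {x : ℝ} (hx : 0 ≤ x) :
    x ^ (1 / 4 : ℝ) * x ^ (1 / 2 : ℝ) = x ^ (3 / 4 : ℝ) := by
  rw [← Real.rpow_add_of_nonneg hx (by norm_num) (by norm_num)]
  norm_num

theorem rpow_half_mul_rpow_half {x : ℝ} (hx : 0 ≤ x) :
    x ^ (1 / 2 : ℝ) * x ^ (1 / 2 : ℝ) = x := by
  rw [← Real.rpow_add_of_nonneg hx (by norm_num) (by norm_num)]
  norm_num

theorem SearchTree.index_of_visits_ne_zero {P : TreeParams} {B : ℕ → ℝ} (hP : P.HasBonus B)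
    {γ : ℝ} {T : SearchTree A} {p : List A} (hp : p.length < P.depth) {a : A}
    (ha : T.visits (a :: p) ≠ 0) :
    T.index P γ p a = ((T.edgeReturn γ (a :: p) / T.visits (a :: p)
      + B (p.length + 1) * (T.visits p : ℝ) ^ (1 / 4 : ℝ)
        / (T.visits (a :: p) : ℝ) ^ (1 / 2 : ℝ) : ℝ) : EReal) := by
  have h1 : p.length + 1 ∈ Finset.Icc 1 P.depth := Finset.mem_Icc.2 ⟨by omega, by omega⟩
  rw [SearchTree.index, if_neg ha, hP.β_rpow _ h1, hP.α_div _ h1, hP.one_sub_η _ h1]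
  rfl

theorem SearchTree.index_le_index_select {P : TreeParams} {γ : ℝ} {tie : TieRule A}
    (htie : tie.Valid) (T : SearchTree A) (p : List A) (b : A) :
    T.index P γ p b ≤ T.index P γ p (T.select P γ tie p) := by
  classical
  obtain ⟨a, -, ha⟩ := Finset.exists_max_image Finset.univ (T.index P γ p)
    (Finset.univ_nonempty (α := A))
  have h1 := htie p (T.visits p)
    (Finset.univ.filter fun a => ∀ b, T.index P γ p b ≤ T.index P γ p a)
    ⟨a, by simpa using ha⟩
  rw [Finset.mem_filter] at h1
  simp only [SearchTree.select]
  convert h1.2 b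

/-- If the returns of the actions deviate from multiples of `Q` by less than the bonus, then the
upper confidence rule selects an action that loses at most the bonus. -/
theorem SearchTree.edgeReturn_select_ge {P : TreeParams} {B : ℕ → ℝ} (hP : P.HasBonus B)
    {γ : ℝ} {tie : TieRule A} (htie : tie.Valid) {T : SearchTree A} {p : List A}
    (hp : p.length < P.depth) {Q : A → ℝ} (hB : 0 ≤ B (p.length + 1))
    (hle : ∀ a, T.visits (a :: p) ≤ T.visits p)
    (hQ : ∀ a, T.visits (a :: p) * Q a - B (p.length + 1)
      * (T.visits (a :: p) : ℝ) ^ (3 / 4 : ℝ) ≤ T.edgeReturn γ (a :: p))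
    (ha0 : T.visits (T.select P γ tie p :: p) ≠ 0) (b : A) :
    T.visits (T.select P γ tie p :: p) * Q b
      - B (p.length + 1) * (T.visits p : ℝ) ^ (1 / 4 : ℝ)
        * (T.visits (T.select P γ tie p :: p) : ℝ) ^ (1 / 2 : ℝ)
      ≤ T.edgeReturn γ (T.select P γ tie p :: p) := by
  have h1 := T.index_le_index_select (P := P) (γ := γ) htie p b
  set a := T.select P γ tie p
  rw [SearchTree.index_of_visits_ne_zero hP hp ha0] at h1
  -- An unvisited action has index `⊤` and would beat the finite index of the selected one.
  have hb0 : T.visits (b :: p) ≠ 0 := fun h => by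
    rw [SearchTree.index, if_pos h, top_le_iff] at h1
    exact EReal.coe_ne_top _ h1
  rw [SearchTree.index_of_visits_ne_zero hP hp hb0, EReal.coe_le_coe_iff] at h1
  set β := B (p.length + 1)
  have key : ∀ c : A, T.visits (c :: p) ≠ 0 → β * (T.visits p : ℝ) ^ (1 / 4 : ℝ)
      / (T.visits (c :: p) : ℝ) ^ (1 / 2 : ℝ) = β * (T.visits p : ℝ) ^ (1 / 4 : ℝ)
        * (T.visits (c :: p) : ℝ) ^ (1 / 2 : ℝ) / T.visits (c :: p) := fun c hc => by
    have h2 : (0 : ℝ) < T.visits (c :: p) := by positivity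
    rw [div_eq_div_iff (by positivity) h2.ne']
    conv_lhs => rw [← rpow_half_mul_rpow_half h2.le]
    ring
  have hNb : (0 : ℝ) < T.visits (b :: p) := by positivity
  have hNa : (0 : ℝ) < T.visits (a :: p) := by positivity
  -- Optimism: since `N(pb) ≤ N(p)`, the bonus covers the deviation of `b`, and the index of `b` is
  -- at least `Q b`.
  have h2 : Q b ≤ T.edgeReturn γ (b :: p) / T.visits (b :: p)
      + β * (T.visits p : ℝ) ^ (1 / 4 : ℝ) / (T.visits (b :: p) : ℝ) ^ (1 / 2 : ℝ) := by
    rw [key b hb0, ← add_div, le_div_iff₀ hNb]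
    have h3 := hQ b
    rw [← rpow_quarter_mul_rpow_half hNb.le] at h3
    have h4 : (T.visits (b :: p) : ℝ) ^ (1 / 4 : ℝ) ≤ (T.visits p : ℝ) ^ (1 / 4 : ℝ) :=
      Real.rpow_le_rpow hNb.le (by exact_mod_cast hle b) (by norm_num)
    have h5 : β * ((T.visits (b :: p) : ℝ) ^ (1 / 4 : ℝ) * (T.visits (b :: p) : ℝ) ^ (1 / 2 : ℝ))
        ≤ β * ((T.visits p : ℝ) ^ (1 / 4 : ℝ) * (T.visits (b :: p) : ℝ) ^ (1 / 2 : ℝ)) := by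
      gcongr
    linarith
  have h3 := h2.trans h1
  rw [key a ha0, ← add_div, le_div_iff₀ hNa] at h3
  linarith

variable {M : DetMDP d A Ξ} {γ : ℝ} {P : TreeParams} {tie : TieRule A} {V : State d → ℝ}
  {s : State d} {W : List A → ℕ → Ξ} {T : SearchTree A} {c K : ℝ}

variable (M γ P V s c K) in
/-- The returns of the actions are not much smaller than the optimum. -/
def SearchTree.LowRegret (T : SearchTree A) : Prop :=
  -- The term `c * K ^ j` is the bonus factor at selection time; the additional `c` pays for the
  -- single simulation that follows the selection.
  ∀ (p : List A) (a : A) (j : ℕ), p.length + (j + 1) = P.depth →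
    T.visits (a :: p) * (M.bellman γ)^[j + 1] V (M.nodeState s p)
      - (c * K ^ j + c) * (T.visits p : ℝ) ^ (1 / 4 : ℝ) * (T.visits (a :: p) : ℝ) ^ (1 / 2 : ℝ)
      ≤ T.edgeReturn γ (a :: p)

theorem SearchTree.Consistent.visits_cons_le (hT : T.Consistent M γ P V s W) {p : List A}
    (hp : p.length < P.depth) (a : A) : T.visits (a :: p) ≤ T.visits p := by
  rw [hT.visits_eq p hp]
  exact Finset.single_le_sum (f := fun a => T.visits (a :: p)) (fun _ _ => Nat.zero_le _)
    (Finset.mem_univ a)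

theorem SearchTree.Consistent.visits_le (hT : T.Consistent M γ P V s W) {p : List A}
    (hp : p.length ≤ P.depth) : T.visits p ≤ T.visits [] := by
  induction p with
  | nil => exact le_rfl
  | cons a p ih =>
    simp only [List.length_cons] at hp
    exact (hT.visits_cons_le (by omega) a).trans (ih (by omega))

/-- The `-1` in the error factor `κ - 1` of the child leaves room for one more deviation `c * N ^
(3/4)`, that of the rewards on the edge; the discount is simply bounded by `1`. -/
theorem SearchTree.Consistent.abs_edgeReturn_sub_le (hT : T.Consistent M γ P V s W)
    (hγ : 0 ≤ γ) (hγ1 : γ < 1) {n : ℕ} (hn : T.visits [] ≤ n)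
    (hW : M.Concentrated P.depth n c s W) {p : List A} (hp : p.length < P.depth) (a : A)
    {w κ : ℝ}
    (h : |T.nodeValue (a :: p) - T.visits (a :: p) * w|
      ≤ c * (κ - 1) * (T.visits (a :: p) : ℝ) ^ (3 / 4 : ℝ)) :
    |T.edgeReturn γ (a :: p)
      - T.visits (a :: p) * (M.meanReward (M.nodeState s p) a + γ * w)|
      ≤ c * κ * (T.visits (a :: p) : ℝ) ^ (3 / 4 : ℝ) := by
  have hp' : (a :: p).length ≤ P.depth := by simpa using hp
  have h1 := hW (a :: p) hp' (T.visits (a :: p)) ((hT.visits_le hp').trans hn)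
  rw [← hT.edgeValue_eq _ hp'] at h1
  simp only [DetMDP.edgeMean] at h1
  set N : ℝ := (T.visits (a :: p) : ℝ)
  have h2 : |γ * (T.nodeValue (a :: p) - N * w)| ≤ c * (κ - 1) * N ^ (3 / 4 : ℝ) := by
    rw [abs_mul, abs_of_nonneg hγ]
    exact (mul_le_of_le_one_left (abs_nonneg _) hγ1.le).trans h
  have h3 : T.edgeReturn γ (a :: p) - N * (M.meanReward (M.nodeState s p) a + γ * w)
      = (T.edgeValue (a :: p) - N * M.meanReward (M.nodeState s p) a)
        + γ * (T.nodeValue (a :: p) - N * w) := by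
    unfold SearchTree.edgeReturn; ring
  rw [h3]
  refine (abs_add_le _ _).trans ((add_le_add h1 h2).trans_eq (by ring))

/-- Induction on the remaining depth. From above, an edge return exceeds `N(pa) * w` by at most `c *
K ^ j * N(p) ^ (3/4)`, because `w` is the maximum over actions. From below, `LowRegret` loses at
most `2 * c * K ^ j * N(p) ^ (3/4)`, as `N(pa) ≤ N(p)`. Summed over the actions this costs the
factor `2 * |A| * K ^ j`, which is at most `K ^ (j+1) - 1` because `K ≥ 2 * |A| + 1` and `K ^ j ≥
1`. -/
theorem SearchTree.Consistent.abs_nodeValue_sub_le (hT : T.Consistent M γ P V s W)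
    (hγ : 0 ≤ γ) (hγ1 : γ < 1) (hc : 0 ≤ c) (hK : 2 * (Fintype.card A : ℝ) + 1 ≤ K)
    (hL : T.LowRegret M γ P V s c K) {n : ℕ} (hn : T.visits [] ≤ n)
    (hW : M.Concentrated P.depth n c s W) (j : ℕ) (p : List A) (hp : p.length + j = P.depth) :
    |T.nodeValue p - T.visits p * (M.bellman γ)^[j] V (M.nodeState s p)|
      ≤ c * (K ^ j - 1) * (T.visits p : ℝ) ^ (3 / 4 : ℝ) := by
  induction j generalizing p with
  | zero => simp [hT.nodeValue_leaf p hp]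
  | succ j ih =>
    have hp' : p.length < P.depth := by omega
    have hcard : (0 : ℝ) ≤ Fintype.card A := by positivity
    have hK1 : 1 ≤ K := by linarith
    have hKj : 1 ≤ K ^ j := one_le_pow₀ hK1
    set w := (M.bellman γ)^[j + 1] V (M.nodeState s p) with hw
    set N : ℝ := (T.visits p : ℝ) with hN
    have hN0 : 0 ≤ N := by positivity
    have hsum : N = ∑ a, (T.visits (a :: p) : ℝ) := by
      rw [hN, hT.visits_eq p hp']; push_cast; rfl
    have hle : ∀ a, (T.visits (a :: p) : ℝ) ≤ N := fun a =>
      Nat.cast_le.2 (hT.visits_cons_le hp' a)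
    have hexp : 0 ≤ c * K ^ j * N ^ (3 / 4 : ℝ) := by positivity
    have hexp1 : 0 ≤ c * N ^ (3 / 4 : ℝ) * (K ^ j - 1) :=
      mul_nonneg (by positivity) (by linarith)
    have hcK : 0 ≤ c * K ^ j * N ^ (3 / 4 : ℝ) * (K - (2 * (Fintype.card A : ℝ) + 1)) :=
      mul_nonneg hexp (by linarith)
    have h1 : ∀ a, T.edgeReturn γ (a :: p) ≤ T.visits (a :: p) * w
        + c * K ^ j * N ^ (3 / 4 : ℝ) := fun a => by
      have h2 := (abs_le.1 (hT.abs_edgeReturn_sub_le hγ hγ1 hn hW hp' a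
        (ih (a :: p) (by simp only [List.length_cons]; omega)))).2
      have h3 : M.meanReward (M.nodeState s p) a
          + γ * (M.bellman γ)^[j] V (M.nodeState s (a :: p)) ≤ w := by
        rw [hw, Function.iterate_succ_apply']
        exact M.le_bellman γ _ _ a
      have h4 := mul_le_mul_of_nonneg_left h3 (Nat.cast_nonneg (α := ℝ) (T.visits (a :: p)))
      have h5 : c * K ^ j * (T.visits (a :: p) : ℝ) ^ (3 / 4 : ℝ)
          ≤ c * K ^ j * N ^ (3 / 4 : ℝ) := by
        have := hle a
        gcongr
      linarith
    have h2 : ∀ a, T.visits (a :: p) * w - 2 * (c * K ^ j * N ^ (3 / 4 : ℝ))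
        ≤ T.edgeReturn γ (a :: p) := fun a => by
      refine le_trans ?_ (hL p a j hp)
      have h3 : (c * K ^ j + c) * N ^ (1 / 4 : ℝ) * (T.visits (a :: p) : ℝ) ^ (1 / 2 : ℝ)
          ≤ (c * K ^ j + c) * N ^ (1 / 4 : ℝ) * N ^ (1 / 2 : ℝ) := by
        have := hle a
        gcongr
      rw [mul_assoc (c * K ^ j + c) (N ^ (1 / 4 : ℝ)) (N ^ (1 / 2 : ℝ)),
        rpow_quarter_mul_rpow_half hN0] at h3
      linarith
    have h3 := Finset.sum_le_sum fun a (_ : a ∈ Finset.univ) => h1 a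
    have h4 := Finset.sum_le_sum fun a (_ : a ∈ Finset.univ) => h2 a
    rw [← hT.nodeValue_eq p hp', Finset.sum_add_distrib, ← Finset.sum_mul, ← hsum,
      Finset.sum_const, Finset.card_univ, nsmul_eq_mul] at h3
    rw [← hT.nodeValue_eq p hp', Finset.sum_sub_distrib, ← Finset.sum_mul, ← hsum,
      Finset.sum_const, Finset.card_univ, nsmul_eq_mul] at h4
    have h5 : 0 ≤ (Fintype.card A : ℝ) * (c * K ^ j * N ^ (3 / 4 : ℝ)) := by positivity
    rw [abs_le, pow_succ]
    constructor <;> nlinarith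

theorem SearchTree.lowRegret_empty :
    (SearchTree.empty A).LowRegret M γ P V s c K := by
  intro p a j _
  simp [SearchTree.empty, SearchTree.edgeReturn]

/-- Only the action selected at a node on the path needs an argument; for its siblings just `N(p)`
grows, which weakens the claim. Before the update the selected action has lost at most the bonus.
The update adds one return and one `w`, each bounded by `R / (1 - γ)`, and this loss of at most `c`
is absorbed by the second summand of `c * K ^ j + c`, the powers of the new counts being at least
`1`. -/
theorem SearchTree.LowRegret.simulate {R : ℝ} (hL : T.LowRegret M γ P V s c K)
    (hT : T.Consistent M γ P V s W)
    (hR : 0 ≤ R) (hM : ∀ s a ζ, |M.reward s a ζ| ≤ R) (hV : ∀ s, |V s| ≤ R / (1 - γ))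
    (hγ : 0 ≤ γ) (hγ1 : γ < 1) (hc : 2 * (R / (1 - γ)) ≤ c)
    (hK : 2 * (Fintype.card A : ℝ) + 1 ≤ K)
    (hP : P.HasBonus fun h => c * K ^ (P.depth - h)) (htie : tie.Valid)
    {n : ℕ} (hn : T.visits [] ≤ n) (hW : M.Concentrated P.depth n c s W) :
    (T.simulate M γ P tie V s W).LowRegret M γ P V s c K := by
  have hVm : 0 ≤ R / (1 - γ) := div_nonneg hR (by linarith)
  have hc0 : 0 ≤ c := by linarith
  have hcard : (0 : ℝ) ≤ Fintype.card A := by positivity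
  have hK1 : 1 ≤ K := by linarith
  intro p a j hp
  have hp' : p.length < P.depth := by omega
  have hKj : 1 ≤ K ^ j := one_le_pow₀ hK1
  have hj : P.depth - (p.length + 1) = j := by omega
  set w := (M.bellman γ)^[j + 1] V (M.nodeState s p) with hw
  have hcK : 0 ≤ c * K ^ j := by positivity
  by_cases h : T.OnPath P γ tie p
  · rw [SearchTree.visits_simulate h]
    by_cases ha : a = T.select P γ tie p
    · have h' := (SearchTree.onPath_cons_iff hp' a).2 ⟨h, ha⟩
      rw [SearchTree.visits_simulate h', SearchTree.edgeReturn_simulate (by simp) h']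
      simp only [List.length_cons, Nat.add_sub_cancel]
      have h1 := (abs_le.1 (SearchTree.abs_nextReturn_le (T := T) (P := P) (tie := tie) (s := s)
        (W := W) hR hγ hγ1 hM hV hp'.le)).1
      have h2 := (abs_le.1 (M.abs_iterate_bellman_le hM hγ hγ1 hV (j + 1) (M.nodeState s p))).2
      rw [← hw] at h2
      have h3 : T.visits (a :: p) * w - c * K ^ j * (T.visits p : ℝ) ^ (1 / 4 : ℝ)
          * (T.visits (a :: p) : ℝ) ^ (1 / 2 : ℝ) ≤ T.edgeReturn γ (a :: p) := by
        by_cases ha0 : T.visits (a :: p) = 0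
        · have h4 := hL p a j hp
          rw [ha0] at h4 ⊢
          simpa using h4
        -- Compared with an action `b` that attains the Bellman maximum, `Q b` becomes `w`.
        · obtain ⟨b, hb⟩ := M.exists_bellman_eq γ ((M.bellman γ)^[j] V) (M.nodeState s p)
          rw [← Function.iterate_succ_apply' (M.bellman γ)] at hb
          have h4 := SearchTree.edgeReturn_select_ge (Q := fun b =>
              M.meanReward (M.nodeState s p) b
                + γ * (M.bellman γ)^[j] V (M.next (M.nodeState s p) b))
            hP htie (T := T) (γ := γ) hp' (by positivity) (hT.visits_cons_le hp') (fun b => by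
              have h5 := (abs_le.1 (hT.abs_edgeReturn_sub_le hγ hγ1 hn hW hp' b
                (hT.abs_nodeValue_sub_le hγ hγ1 hc0 hK hL hn hW j (b :: p)
                  (by simp only [List.length_cons]; omega)))).1
              rw [hj]
              simp only [DetMDP.nodeState] at h5
              linarith) (ha ▸ ha0) b
          rw [← ha, hj, ← hb] at h4
          exact h4
      have h4 : (T.visits p : ℝ) ^ (1 / 4 : ℝ) ≤ ((T.visits p + 1 : ℕ) : ℝ) ^ (1 / 4 : ℝ) :=
        Real.rpow_le_rpow (by positivity) (by push_cast; linarith) (by norm_num)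
      have h5 : (T.visits (a :: p) : ℝ) ^ (1 / 2 : ℝ)
          ≤ ((T.visits (a :: p) + 1 : ℕ) : ℝ) ^ (1 / 2 : ℝ) :=
        Real.rpow_le_rpow (by positivity) (by push_cast; linarith) (by norm_num)
      have h6 : (1 : ℝ) ≤ ((T.visits p + 1 : ℕ) : ℝ) ^ (1 / 4 : ℝ) :=
        Real.one_le_rpow (by push_cast; linarith [Nat.cast_nonneg (α := ℝ) (T.visits p)])
          (by norm_num)
      have h7 : (1 : ℝ) ≤ ((T.visits (a :: p) + 1 : ℕ) : ℝ) ^ (1 / 2 : ℝ) :=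
        Real.one_le_rpow (by push_cast; linarith [Nat.cast_nonneg (α := ℝ) (T.visits (a :: p))])
          (by norm_num)
      have h8 : c * K ^ j * (T.visits p : ℝ) ^ (1 / 4 : ℝ) * (T.visits (a :: p) : ℝ) ^ (1 / 2 : ℝ)
          ≤ c * K ^ j * ((T.visits p + 1 : ℕ) : ℝ) ^ (1 / 4 : ℝ)
            * ((T.visits (a :: p) + 1 : ℕ) : ℝ) ^ (1 / 2 : ℝ) := by gcongr
      have h9 : c ≤ c * ((T.visits p + 1 : ℕ) : ℝ) ^ (1 / 4 : ℝ)
            * ((T.visits (a :: p) + 1 : ℕ) : ℝ) ^ (1 / 2 : ℝ) := by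
        rw [mul_assoc]
        exact le_mul_of_one_le_right hc0 (one_le_mul_of_one_le_of_one_le h6 h7)
      have h10 : ((T.visits (a :: p) + 1 : ℕ) : ℝ) * w = T.visits (a :: p) * w + w := by
        push_cast; ring
      rw [add_mul, add_mul, h10]
      linarith
    · rw [SearchTree.visits_simulate' fun h' => ha ((SearchTree.onPath_cons_iff hp' a).1 h').2,
        SearchTree.edgeReturn_simulate' fun h' => ha ((SearchTree.onPath_cons_iff hp' a).1 h').2]
      refine le_trans ?_ (hL p a j hp)
      gcongr
      omega
  · rw [SearchTree.visits_simulate' h,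
      SearchTree.visits_simulate' fun h' => h ((SearchTree.onPath_cons_iff hp' a).1 h').1,
      SearchTree.edgeReturn_simulate' fun h' => h ((SearchTree.onPath_cons_iff hp' a).1 h').1]
    exact hL p a j hp

/-- With concentrated rewards and suitable bonus terms, the output of tree search with `n`
simulations is within `O(n ^ (-1/4))` of the value of the depth-`H` lookahead. -/
theorem abs_mcts_sub_le {R : ℝ}
    (hR : 0 ≤ R) (hM : ∀ s a ζ, |M.reward s a ζ| ≤ R) (hV : ∀ s, |V s| ≤ R / (1 - γ))
    (hγ : 0 ≤ γ) (hγ1 : γ < 1) (hc : 2 * (R / (1 - γ)) ≤ c)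
    (hK : 2 * (Fintype.card A : ℝ) + 1 ≤ K)
    (hP : P.HasBonus fun h => c * K ^ (P.depth - h)) (hsims : 1 ≤ P.sims) (htie : tie.Valid)
    (hW : M.Concentrated P.depth P.sims c s W) :
    |mcts M γ P tie V s W - (M.bellman γ)^[P.depth] V s|
      ≤ c * K ^ P.depth / (P.sims : ℝ) ^ (1 / 4 : ℝ) := by
  have hVm : 0 ≤ R / (1 - γ) := div_nonneg hR (by linarith)
  have hc0 : 0 ≤ c := by linarith
  have hK0 : 0 ≤ K := by linarith [Nat.cast_nonneg (α := ℝ) (Fintype.card A)]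
  have hlow : ∀ k ≤ P.sims, ((SearchTree.simulate M γ P tie V s W)^[k]
      (SearchTree.empty A)).LowRegret M γ P V s c K := by
    intro k
    induction k with
    | zero => exact fun _ => SearchTree.lowRegret_empty
    | succ k ih =>
      intro hk
      rw [Function.iterate_succ_apply']
      exact (ih (by omega)).simulate (SearchTree.consistent_iterate k) hR hM hV hγ hγ1 hc hK hP
        htie (n := P.sims) (by rw [SearchTree.visits_iterate_nil]; omega) hW
  have h1 := (SearchTree.consistent_iterate (M := M) (γ := γ) (tie := tie) (V := V) (s := s)
    (P := P) (W := W) P.sims).abs_nodeValue_sub_le hγ hγ1 hc0 hK (hlow _ le_rfl)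
    (n := P.sims) (by rw [SearchTree.visits_iterate_nil]) hW P.depth [] (by simp)
  rw [SearchTree.visits_iterate_nil] at h1
  have hn : (0 : ℝ) < P.sims := by exact_mod_cast hsims
  have h2 : mcts M γ P tie V s W - (M.bellman γ)^[P.depth] V s
      = (((SearchTree.simulate M γ P tie V s W)^[P.sims] (SearchTree.empty A)).nodeValue []
        - P.sims * (M.bellman γ)^[P.depth] V s) / P.sims := by
    unfold mcts searchTree
    field_simp
  have h3 : (P.sims : ℝ) ^ (3 / 4 : ℝ) * (P.sims : ℝ) ^ (1 / 4 : ℝ) = P.sims := by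
    rw [← Real.rpow_add hn]; norm_num
  rw [h2, abs_div, Nat.abs_cast, div_le_div_iff₀ hn (by positivity)]
  calc _ ≤ c * (K ^ P.depth - 1) * (P.sims : ℝ) ^ (3 / 4 : ℝ) * (P.sims : ℝ) ^ (1 / 4 : ℝ) := by
        gcongr; exact h1
    _ ≤ c * K ^ P.depth * (P.sims : ℝ) ^ (3 / 4 : ℝ) * (P.sims : ℝ) ^ (1 / 4 : ℝ) := by
        gcongr; linarith
    _ = c * K ^ P.depth * P.sims := by rw [mul_assoc, h3]

end Concentration

/-! ### The Bellman equation -/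

section BellmanEquation

variable {d : ℕ} {A Ξ : Type*} [Fintype A] [Nonempty A] [MeasurableSpace A]
  [DiscreteMeasurableSpace A] [MeasurableSpace Ξ] {γ R : ℝ}

theorem DetMDP.measurable_next_uncurry (M : DetMDP d A Ξ) :
    Measurable fun x : State d × A × Ξ => M.next x.1 x.2.1 := by
  have h1 : Measurable fun x : State d × A => M.next x.1 x.2 :=
    measurable_from_prod_countable_left M.measurable_next
  exact h1.comp (measurable_fst.prodMk measurable_snd.fst)

theorem DetMDP.measurable_reward_uncurry (M : DetMDP d A Ξ) :
    Measurable fun x : State d × A × Ξ => M.reward x.1 x.2.1 x.2.2 := by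
  have h1 : Measurable fun x : (State d × Ξ) × A => M.reward x.1.1 x.2 x.1.2 :=
    measurable_from_prod_countable_left M.measurable_reward
  exact h1.comp ((measurable_fst.prodMk measurable_snd.snd).prodMk measurable_snd.fst)

theorem DetMDP.measurable_meanReward (M : DetMDP d A Ξ) (a : A) :
    Measurable fun s => M.meanReward s a :=
  (M.measurable_reward a).stronglyMeasurable.integral_prod_right.measurable

theorem DetMDP.measurable_bellman (M : DetMDP d A Ξ) {V : State d → ℝ} (hV : Measurable V) :
    Measurable (M.bellman γ V) := by
  have h : M.bellman γ V = Finset.univ.sup' Finset.univ_nonempty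
      fun a s => M.meanReward s a + γ * V (M.next s a) := by
    ext s
    rw [Finset.sup'_apply]
    rfl
  rw [h]
  exact Finset.measurable_sup' _ fun a _ =>
    (M.measurable_meanReward a).add ((hV.comp (M.measurable_next a)).const_mul γ)

theorem DetMDP.measurable_iterate_bellman (M : DetMDP d A Ξ) {V : State d → ℝ}
    (hV : Measurable V) (k : ℕ) : Measurable ((M.bellman γ)^[k] V) := by
  induction k with
  | zero => exact hV
  | succ k ih =>
    rw [Function.iterate_succ_apply']
    exact M.measurable_bellman ih

/-- The set of maximizing actions is a measurable function of the state into the finite space `A →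
Bool`, on which any choice function is measurable. -/
theorem DetMDP.exists_measurable_greedy (M : DetMDP d A Ξ) {V : State d → ℝ}
    (hV : Measurable V) : ∃ f : State d → A, Measurable f ∧
      ∀ s, M.bellman γ V s = M.meanReward s (f s) + γ * V (M.next s (f s)) := by
  classical
  let S : State d → A → Bool := fun s a =>
    decide (M.bellman γ V s = M.meanReward s a + γ * V (M.next s a))
  have hS : Measurable S := measurable_pi_iff.2 fun a => by
    refine measurable_to_bool ?_
    have : (fun s => S s a) ⁻¹' {true}
        = {s | M.bellman γ V s = M.meanReward s a + γ * V (M.next s a)} := by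
      ext s; simp [S]
    rw [this]
    exact measurableSet_eq_fun (M.measurable_bellman hV)
      ((M.measurable_meanReward a).add ((hV.comp (M.measurable_next a)).const_mul γ))
  let g : (A → Bool) → A := fun b => if h : ∃ a, b a = true then h.choose else Classical.arbitrary A
  have hg : Measurable g := measurable_of_countable _
  refine ⟨g ∘ S, hg.comp hS, fun s => ?_⟩
  have h : ∃ a, S s a = true := by
    obtain ⟨a, ha⟩ := M.exists_bellman_eq γ V s
    exact ⟨a, by simpa [S] using ha⟩
  have h1 := h.choose_spec
  have h2 : (g ∘ S) s = h.choose := by simp only [g, Function.comp_apply, dif_pos h]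
  rw [h2]
  simpa [S] using h1

theorem integral_comp_eq {α β : Type*} [MeasurableSpace α] [MeasurableSpace β] {μ : Measure α}
    [IsProbabilityMeasure μ] {κ : Kernel α β} [IsMarkovKernel κ] {f : β → ℝ}
    (hf : Integrable f (κ ∘ₘ μ)) : ∫ y, f y ∂(κ ∘ₘ μ) = ∫ x, ∫ y, f y ∂(κ x) ∂μ := by
  rw [Measure.comp_eq_comp_const_apply] at hf ⊢
  rw [Kernel.integral_comp hf, Kernel.const_apply]

theorem integrable_of_measurable_of_abs_le {α : Type*} [MeasurableSpace α] {μ : Measure α}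
    [IsFiniteMeasure μ] {f : α → ℝ} (hf : Measurable f) {b : ℝ} (hb : ∀ x, |f x| ≤ b) :
    Integrable f μ :=
  Integrable.of_bound hf.aestronglyMeasurable b (Filter.Eventually.of_forall hb)

theorem abs_integral_le_of_abs_le {α : Type*} [MeasurableSpace α] {μ : Measure α}
    [IsProbabilityMeasure μ] {f : α → ℝ} {b : ℝ} (hb : ∀ x, |f x| ≤ b) : |∫ x, f x ∂μ| ≤ b := by
  simpa using norm_integral_le_of_norm_le_const (μ := μ) (f := f) (C := b)
    (Filter.Eventually.of_forall hb)

theorem integral_add_mul_sub {α : Type*} [MeasurableSpace α] {μ : Measure α} {f g h : α → ℝ}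
    (hf : Integrable f μ) (hg : Integrable g μ) (hh : Integrable h μ) (γ : ℝ) :
    ∫ x, (f x + γ * g x - h x) ∂μ = ∫ x, f x ∂μ + γ * ∫ x, g x ∂μ - ∫ x, h x ∂μ := by
  rw [integral_sub (f := fun x => f x + γ * g x) (hf.add (hg.const_mul γ)) hh,
    integral_add (g := fun x => γ * g x) hf (hg.const_mul γ), integral_const_mul]

variable (M : DetMDP d A Ξ) (π : Kernel (State d) A) [IsMarkovKernel π]

instance (s : State d) : IsProbabilityMeasure (M.trajectory π s) := by
  unfold DetMDP.trajectory; infer_instance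

theorem DetMDP.stepKernel_apply (s : State d) :
    M.stepKernel π s = (Measure.dirac s).prod ((π s).prod M.noise) := by
  rw [DetMDP.stepKernel, Kernel.prod_apply, Kernel.prod_apply, Kernel.const_apply,
    Kernel.id_apply]

theorem DetMDP.integral_stepKernel {f : State d × A × Ξ → ℝ} (hf : Measurable f) {b : ℝ}
    (hb : ∀ x, |f x| ≤ b) (s : State d) :
    ∫ x, f x ∂(M.stepKernel π s) = ∫ a, ∫ ζ, f (s, a, ζ) ∂M.noise ∂(π s) := by
  have h2 : StronglyMeasurable (Function.uncurry fun (s' : State d) (y : A × Ξ) => f (s', y)) :=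
    hf.stronglyMeasurable
  rw [DetMDP.stepKernel_apply, integral_prod _ (integrable_of_measurable_of_abs_le hf hb),
    integral_dirac' _ _ h2.integral_prod_right,
    integral_prod _ (integrable_of_measurable_of_abs_le (f := fun y => f (s, y))
      (hf.comp measurable_prodMk_left) fun x => hb (s, x))]

theorem DetMDP.map_eval_zero_trajectory (s : State d) :
    (M.trajectory π s).map (fun x => x 0) = M.stepKernel π s := by
  have h1 : (fun x : ℕ → State d × A × Ξ => x 0)
      = (fun y : (i : Finset.Iic 0) → State d × A × Ξ => y ⟨0, Finset.mem_Iic.2 le_rfl⟩)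
        ∘ Preorder.frestrictLe 0 := rfl
  have h2 := Preorder.measurable_frestrictLe (X := fun _ : ℕ => State d × A × Ξ) 0
  rw [h1, ← Measure.map_map (measurable_pi_apply _) h2]
  unfold DetMDP.trajectory Kernel.trajMeasure
  rw [Measure.map_comp _ _ h2, Kernel.traj_map_frestrictLe,
    Kernel.partialTraj_self, Measure.id_comp, Measure.map_map (measurable_pi_apply _)
      (MeasurableEquiv.measurable _)]
  exact Measure.map_id

/-- Markov property: the transition kernels of the trajectory see the history only through
`nextOfHistory`. -/
theorem DetMDP.map_eval_succ_trajectory (s : State d) (t : ℕ) :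
    (M.trajectory π s).map (fun x => x (t + 1)) = (M.stepKernel π) ∘ₘ
      ((M.trajectory π s).map (fun x => M.next (x t).1 (x t).2.1)) := by
  have h := Kernel.map_frestrictLe_trajMeasure_compProd_eq_map_trajMeasure
    (X := fun _ => State d × A × Ξ) (μ₀ := M.stepKernel π s) (a := t)
    (κ := fun n => (M.stepKernel π).comap (M.nextOfHistory n) (M.measurable_nextOfHistory n))
  have h1 := congrArg Measure.snd h
  rw [Measure.snd_compProd, Measure.snd, Measure.map_map measurable_snd (by fun_prop),
    ← Kernel.comp_deterministic_eq_comap, ← Measure.comp_assoc,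
    Measure.deterministic_comp_eq_map, Measure.map_map (M.measurable_nextOfHistory t)
      (Preorder.measurable_frestrictLe t)] at h1
  exact h1.symm

/-- Multiply the drift inequality by `γ ^ t` and sum: the `g` terms telescope to `g 0`, and `κ`
contributes a geometric series. -/
theorem tsum_le_of_telescope {r g : ℕ → ℝ} {b b' κ : ℝ} (hγ : 0 ≤ γ) (hγ1 : γ < 1)
    (hr : ∀ t, |r t| ≤ b) (hg : ∀ t, |g t| ≤ b') (h : ∀ t, r t + γ * g (t + 1) - g t ≤ κ) :
    ∑' t, γ ^ t * r t ≤ g 0 + κ / (1 - γ) := by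
  have hgeom := summable_geometric_of_lt_one hγ hγ1
  have hsum : ∀ {f : ℕ → ℝ} {b : ℝ}, (∀ t, |f t| ≤ b) → Summable fun t => γ ^ t * f t := by
    intro f b hf
    refine Summable.of_norm_bounded (hgeom.mul_right b) fun t => ?_
    rw [norm_mul, norm_pow, Real.norm_of_nonneg hγ]
    exact mul_le_mul_of_nonneg_left (hf t) (pow_nonneg hγ t)
  have h1 := hsum hg
  have h2 : ∑' t, γ ^ t * g t = g 0 + ∑' t, γ ^ (t + 1) * g (t + 1) := by
    rw [h1.tsum_eq_zero_add]; simp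
  have h3 : Summable fun t => γ ^ (t + 1) * g (t + 1) := (summable_nat_add_iff 1).2 h1
  have h4 : ∑' t, γ ^ t * r t
      ≤ ∑' t, (γ ^ t * κ + γ ^ t * g t - γ ^ (t + 1) * g (t + 1)) := by
    refine Summable.tsum_le_tsum (fun t => ?_) (hsum hr) (((hgeom.mul_right κ).add h1).sub h3)
    have := mul_le_mul_of_nonneg_left (h t) (pow_nonneg hγ t)
    rw [pow_succ]
    linarith
  rw [((hgeom.mul_right κ).add h1).tsum_sub h3, (hgeom.mul_right κ).tsum_add h1, h2,
    tsum_mul_right, tsum_geometric_of_lt_one hγ hγ1] at h4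
  rw [div_eq_inv_mul]
  linarith

/-- The policy value as the discounted sum of the expected rewards. -/
theorem DetMDP.policyValue_eq_tsum (hγ : 0 ≤ γ) (hγ1 : γ < 1)
    (hM : ∀ s a ζ, |M.reward s a ζ| ≤ R) (s : State d) :
    M.policyValue γ π s = ∑' t, γ ^ t * ∫ x, M.reward (x t).1 (x t).2.1 (x t).2.2
      ∂(M.trajectory π s) := by
  have hR : 0 ≤ R := (abs_nonneg _).trans
    (hM s (Classical.arbitrary A) (Classical.choice M.noise.nonempty_of_neZero))
  have hm : ∀ t, Measurable fun x : ℕ → State d × A × Ξ =>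
      γ ^ t * M.reward (x t).1 (x t).2.1 (x t).2.2 := fun t =>
    (M.measurable_reward_uncurry.comp (measurable_pi_apply t)).const_mul _
  have hb : ∀ t (x : ℕ → State d × A × Ξ),
      |γ ^ t * M.reward (x t).1 (x t).2.1 (x t).2.2| ≤ γ ^ t * R := fun t x => by
    rw [abs_mul, abs_of_nonneg (pow_nonneg hγ t)]
    exact mul_le_mul_of_nonneg_left (hM _ _ _) (pow_nonneg hγ t)
  have hi : ∀ t, Integrable (fun x : ℕ → State d × A × Ξ =>
      γ ^ t * M.reward (x t).1 (x t).2.1 (x t).2.2) (M.trajectory π s) := fun t =>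
    integrable_of_measurable_of_abs_le (hm t) (hb t)
  have h := integral_tsum_of_summable_integral_norm hi (Summable.of_nonneg_of_le
    (fun t => integral_nonneg fun x => norm_nonneg _)
    (fun t => (integral_mono (hi t).norm (integrable_const (γ ^ t * R)) (hb t)).trans_eq
      (by simp)) ((summable_geometric_of_lt_one hγ hγ1).mul_right R))
  unfold DetMDP.policyValue
  rw [← h]
  simp only [integral_const_mul]

variable {M π}

/-! ### Policy values from a one-step drift condition -/

section PerformanceDifference

variable {U : State d → ℝ} {b κ : ℝ}

theorem DetMDP.integral_fst_stepKernel_comp (hU : Measurable U) (hb : ∀ s, |U s| ≤ b)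
    (ρ : Measure (State d)) [IsProbabilityMeasure ρ] :
    ∫ x, U x.1 ∂((M.stepKernel π) ∘ₘ ρ) = ∫ s, U s ∂ρ := by
  have hm : Measurable fun x : State d × A × Ξ => U x.1 := hU.comp measurable_fst
  rw [integral_comp_eq (integrable_of_measurable_of_abs_le hm fun x => hb x.1)]
  congr with s
  rw [M.integral_stepKernel π hm fun x => hb x.1]
  simp

/-- If the one-step look-ahead `r + γ U` is uniformly close to `U` along a policy, then the value
of the policy is close to `U`; the signs `σ = ±1` give upper and lower bounds. -/
theorem DetMDP.mul_policyValue_le (hγ : 0 ≤ γ) (hγ1 : γ < 1)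
    (hM : ∀ s a ζ, |M.reward s a ζ| ≤ R) (hU : Measurable U) (hb : ∀ s, |U s| ≤ b) {σ : ℝ}
    (h : ∀ s, ∀ᵐ a ∂(π s), σ * (M.meanReward s a + γ * U (M.next s a) - U s) ≤ κ)
    (s : State d) :
    σ * M.policyValue γ π s ≤ σ * U s + κ / (1 - γ) := by
  set μ : ℕ → Measure (State d × A × Ξ) := fun t => (M.trajectory π s).map (fun x => x t) with hμ
  have hμp : ∀ t, IsProbabilityMeasure (μ t) := fun t =>
    Measure.isProbabilityMeasure_map (measurable_pi_apply t).aemeasurable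
  set r : ℕ → ℝ := fun t => ∫ x, M.reward x.1 x.2.1 x.2.2 ∂(μ t) with hr
  set g : ℕ → ℝ := fun t => ∫ x, U x.1 ∂(μ t) with hg
  have hmr := M.measurable_reward_uncurry
  have hmn := M.measurable_next_uncurry
  have hmU : Measurable fun x : State d × A × Ξ => U x.1 := hU.comp measurable_fst
  -- Each time marginal is one policy step from some law of states, so an expectation at time `t`
  -- reduces to averages over `π s'` for single states `s'`.
  have hstep : ∀ t, ∃ ρ : Measure (State d), IsProbabilityMeasure ρ ∧
      μ t = (M.stepKernel π) ∘ₘ ρ := by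
    intro t
    cases t with
    | zero =>
      refine ⟨Measure.dirac s, inferInstance, ?_⟩
      rw [hμ]
      simp only [M.map_eval_zero_trajectory π s]
      rw [Measure.dirac_bind (M.stepKernel π).measurable]
    | succ t =>
      refine ⟨_, Measure.isProbabilityMeasure_map
        (hmn.comp (measurable_pi_apply t)).aemeasurable, M.map_eval_succ_trajectory π s t⟩
  have hg_succ : ∀ t, g (t + 1) = ∫ x, U (M.next x.1 x.2.1) ∂(μ t) := by
    intro t
    have hmnt : Measurable fun x : ℕ → State d × A × Ξ => M.next (x t).1 (x t).2.1 :=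
      hmn.comp (measurable_pi_apply t)
    have : IsProbabilityMeasure
        ((M.trajectory π s).map fun x => M.next (x t).1 (x t).2.1) :=
      Measure.isProbabilityMeasure_map hmnt.aemeasurable
    simp only [hg, hμ, M.map_eval_succ_trajectory π s t]
    rw [DetMDP.integral_fst_stepKernel_comp hU hb,
      integral_map hmnt.aemeasurable hU.aestronglyMeasurable,
      integral_map (measurable_pi_apply t).aemeasurable (hU.comp hmn).aestronglyMeasurable]
  have hdrift : ∀ t, σ * r t + γ * (σ * g (t + 1)) - σ * g t ≤ κ := by
    intro t
    obtain ⟨ρ, hρ, hρt⟩ := hstep t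
    have i1 := integrable_of_measurable_of_abs_le (μ := μ t) hmr fun x => hM _ _ _
    have i2 := integrable_of_measurable_of_abs_le (μ := μ t)
      (f := fun x => U (M.next x.1 x.2.1)) (hU.comp hmn) fun x => hb _
    have i3 := integrable_of_measurable_of_abs_le (μ := μ t) hmU fun x => hb _
    have hmf : Measurable fun x : State d × A × Ξ => M.reward x.1 x.2.1 x.2.2
        + γ * U (M.next x.1 x.2.1) - U x.1 := (hmr.add ((hU.comp hmn).const_mul γ)).sub hmU
    have hbf : ∀ x : State d × A × Ξ, |M.reward x.1 x.2.1 x.2.2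
        + γ * U (M.next x.1 x.2.1) - U x.1| ≤ R + γ * b + b := fun x => by
      refine (abs_sub _ _).trans (add_le_add ((abs_add_le _ _).trans (add_le_add (hM _ _ _) ?_))
        (hb _))
      rw [abs_mul, abs_of_nonneg hγ]
      exact mul_le_mul_of_nonneg_left (hb _) hγ
    have e : σ * r t + γ * (σ * g (t + 1)) - σ * g t = σ * ∫ x, (M.reward x.1 x.2.1 x.2.2
        + γ * U (M.next x.1 x.2.1) - U x.1) ∂(μ t) := by
      rw [integral_add_mul_sub i1 i2 i3, hg_succ t]
      ring
    rw [e, hρt, integral_comp_eq (integrable_of_measurable_of_abs_le hmf hbf),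
      ← integral_const_mul]
    have hinner : ∀ s', σ * ∫ x, (M.reward x.1 x.2.1 x.2.2 + γ * U (M.next x.1 x.2.1) - U x.1)
        ∂(M.stepKernel π s') ≤ κ := by
      intro s'
      rw [M.integral_stepKernel π hmf hbf, ← integral_const_mul]
      have h1 : ∀ a, ∫ ζ, (M.reward s' a ζ + γ * U (M.next s' a) - U s') ∂M.noise
          = M.meanReward s' a + γ * U (M.next s' a) - U s' := fun a => by
        have i4 := integrable_of_measurable_of_abs_le (μ := M.noise) (f := M.reward s' a)
          ((M.measurable_reward a).comp measurable_prodMk_left) fun ζ => hM s' a ζ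
        rw [integral_add_mul_sub i4 (integrable_const (U (M.next s' a)))
          (integrable_const (U s'))]
        simp [DetMDP.meanReward]
      simp only [h1]
      refine (integral_mono_ae ?_ (integrable_const κ) (h s')).trans_eq (by simp)
      exact Integrable.of_finite
    refine (integral_mono (Integrable.const_mul ?_ σ) (integrable_const κ) hinner).trans_eq
      (by simp)
    exact integrable_of_measurable_of_abs_le (b := R + γ * b + b)
      hmf.stronglyMeasurable.integral_kernel.measurable fun s' =>
        abs_integral_le_of_abs_le hbf
  have hkey := tsum_le_of_telescope (b := |σ| * R) (b' := |σ| * b) hγ hγ1 (r := fun t => σ * r t)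
    (g := fun t => σ * g t)
    (fun t => by
      rw [abs_mul]
      exact mul_le_mul_of_nonneg_left (abs_integral_le_of_abs_le fun _ => hM _ _ _)
        (abs_nonneg σ))
    (fun t => by
      rw [abs_mul]
      exact mul_le_mul_of_nonneg_left (abs_integral_le_of_abs_le fun _ => hb _)
        (abs_nonneg σ)) hdrift
  have h0 : g 0 = U s := by
    simp only [hg, hμ, M.map_eval_zero_trajectory π s]
    rw [M.integral_stepKernel π hmU fun x => hb x.1]
    simp
  rw [h0] at hkey
  refine le_of_eq_of_le ?_ hkey
  rw [M.policyValue_eq_tsum π hγ hγ1 hM s, ← tsum_mul_left]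
  refine tsum_congr fun t => ?_
  simp only [hr, hμ]
  rw [integral_map (measurable_pi_apply t).aemeasurable hmr.aestronglyMeasurable]
  ring

end PerformanceDifference

/-! ### Value iteration from zero and the optimal value -/

variable (M)

/-- The Bellman residual of the `k`-th iterate is a `k`-fold contraction of the first step, which is
bounded by `R`. -/
theorem DetMDP.abs_iterate_bellman_zero_succ_sub_le (hγ : 0 ≤ γ)
    (hM : ∀ s a ζ, |M.reward s a ζ| ≤ R) (k : ℕ) (s : State d) :
    |M.bellman γ ((M.bellman γ)^[k] 0) s - (M.bellman γ)^[k] 0 s| ≤ γ ^ k * R := by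
  rw [← Function.iterate_succ_apply' (M.bellman γ), Function.iterate_succ_apply]
  refine M.abs_iterate_bellman_sub_le hγ (fun s => ?_) k s
  obtain ⟨a, ha⟩ := M.exists_bellman_eq γ 0 s
  simpa [ha] using M.abs_meanReward_le hM s a

/-- The drift of the iterate along any action is at most its Bellman residual `γ ^ k * R`, which
accumulates geometrically. -/
theorem DetMDP.policyValue_le (hγ : 0 ≤ γ) (hγ1 : γ < 1) (hR : 0 ≤ R)
    (hM : ∀ s a ζ, |M.reward s a ζ| ≤ R) (π : Kernel (State d) A) [IsMarkovKernel π] (k : ℕ)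
    (s : State d) :
    M.policyValue γ π s ≤ (M.bellman γ)^[k] 0 s + γ ^ k * R / (1 - γ) := by
  have h := DetMDP.mul_policyValue_le (M := M) (π := π) (σ := 1) (κ := γ ^ k * R) hγ hγ1 hM
    (M.measurable_iterate_bellman measurable_zero k)
    (M.abs_iterate_bellman_le hM hγ hγ1 (V := 0) (fun s => by
      simpa using div_nonneg hR (by linarith)) k)
    (fun s => Filter.Eventually.of_forall fun a => by
      have h1 := M.le_bellman γ ((M.bellman γ)^[k] 0) s a
      have h2 := (abs_le.1 (M.abs_iterate_bellman_zero_succ_sub_le hγ hM k s)).2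
      linarith) s
  simpa using h

theorem DetMDP.exists_le_policyValue (hγ : 0 ≤ γ) (hγ1 : γ < 1) (hR : 0 ≤ R)
    (hM : ∀ s a ζ, |M.reward s a ζ| ≤ R) (k : ℕ) :
    ∃ π : {π : Kernel (State d) A // IsMarkovKernel π}, ∀ s,
      haveI := π.2
      (M.bellman γ)^[k] 0 s - γ ^ k * R / (1 - γ) ≤ M.policyValue γ π.1 s := by
  have hm : Measurable ((M.bellman γ)^[k] 0) := M.measurable_iterate_bellman measurable_zero k
  obtain ⟨f, hf, hgreedy⟩ := M.exists_measurable_greedy (γ := γ) hm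
  refine ⟨⟨Kernel.deterministic f hf, inferInstance⟩, fun s => ?_⟩
  have h := DetMDP.mul_policyValue_le (M := M) (π := Kernel.deterministic f hf) (σ := -1)
    (κ := γ ^ k * R) hγ hγ1 hM hm
    (M.abs_iterate_bellman_le hM hγ hγ1 (V := 0) (fun s => by
      simpa using div_nonneg hR (by linarith)) k)
    (fun s => by
      -- The drift condition is only required almost surely under the policy, hence only for the
      -- greedy action, where the drift equals the Bellman residual.
      rw [Kernel.deterministic_apply, ae_dirac_eq]
      simp only [Filter.eventually_pure]
      have h2 := (abs_le.1 (M.abs_iterate_bellman_zero_succ_sub_le hγ hM k s)).1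
      rw [hgreedy s] at h2
      linarith) s
  linarith

theorem DetMDP.abs_optimalValue_sub_iterate_le (hγ : 0 ≤ γ) (hγ1 : γ < 1) (hR : 0 ≤ R)
    (hM : ∀ s a ζ, |M.reward s a ζ| ≤ R) (k : ℕ) (s : State d) :
    |M.optimalValue γ s - (M.bellman γ)^[k] 0 s| ≤ γ ^ k * R / (1 - γ) := by
  obtain ⟨π, hπ⟩ := M.exists_le_policyValue hγ hγ1 hR hM k
  have : Nonempty {π : Kernel (State d) A // IsMarkovKernel π} := ⟨π⟩
  have hub : ∀ π : {π : Kernel (State d) A // IsMarkovKernel π},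
      haveI := π.2
      M.policyValue γ π.1 s ≤ (M.bellman γ)^[k] 0 s + γ ^ k * R / (1 - γ) := fun π =>
    haveI := π.2
    M.policyValue_le hγ hγ1 hR hM π.1 k s
  have h1 : M.optimalValue γ s ≤ _ := ciSup_le hub
  have h2 := (hπ s).trans (le_ciSup (f := fun π : {π : Kernel (State d) A // IsMarkovKernel π} =>
    haveI := π.2
    M.policyValue γ π.1 s) ⟨_, Set.forall_mem_range.2 hub⟩ π)
  have h3 : M.optimalValue γ s = ⨆ π : {π : Kernel (State d) A // IsMarkovKernel π},
    haveI := π.2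
    M.policyValue γ π.1 s := rfl
  rw [← h3] at h2
  rw [abs_le]
  constructor <;> linarith

theorem DetMDP.abs_optimalValue_le (hγ : 0 ≤ γ) (hγ1 : γ < 1) (hR : 0 ≤ R)
    (hM : ∀ s a ζ, |M.reward s a ζ| ≤ R) (s : State d) :
    |M.optimalValue γ s| ≤ R / (1 - γ) := by
  simpa using M.abs_optimalValue_sub_iterate_le hγ hγ1 hR hM 0 s

/-- The depth-`H` lookahead contracts towards the optimal value function. -/
theorem DetMDP.abs_iterate_bellman_sub_optimalValue_le (hγ : 0 ≤ γ) (hγ1 : γ < 1) (hR : 0 ≤ R)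
    (hM : ∀ s a ζ, |M.reward s a ζ| ≤ R) {V : State d → ℝ} {b : ℝ}
    (hV : ∀ s, |V s - M.optimalValue γ s| ≤ b) (H : ℕ) (s : State d) :
    |(M.bellman γ)^[H] V s - M.optimalValue γ s| ≤ γ ^ H * b := by
  -- The comparison goes through the iterate of order `H + k` on `0`, so that the optimal value need
  -- not be shown to solve the Bellman equation; `k → ∞` removes the extra terms.
  have h : ∀ k, |(M.bellman γ)^[H] V s - M.optimalValue γ s|
      ≤ γ ^ H * (b + γ ^ k * (R / (1 - γ))) + γ ^ (H + k) * (R / (1 - γ)) := fun k => by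
    have h1 := M.abs_iterate_bellman_sub_le hγ (V := V) (V' := (M.bellman γ)^[k] 0)
      (b := b + γ ^ k * (R / (1 - γ))) (fun s => by
        have h2 := M.abs_optimalValue_sub_iterate_le hγ hγ1 hR hM k s
        rw [mul_div_assoc] at h2
        exact (abs_sub_le _ _ _).trans (add_le_add (hV s) h2)) H s
    have h2 := M.abs_optimalValue_sub_iterate_le hγ hγ1 hR hM (H + k) s
    rw [← Function.iterate_add_apply] at h1
    rw [abs_sub_comm, mul_div_assoc] at h2
    exact (abs_sub_le _ _ _).trans (add_le_add h1 h2)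
  have ht : Filter.Tendsto (fun k : ℕ => γ ^ H * (b + γ ^ k * (R / (1 - γ)))
      + γ ^ (H + k) * (R / (1 - γ))) Filter.atTop
      (𝓝 (γ ^ H * (b + 0 * (R / (1 - γ))) + γ ^ H * 0 * (R / (1 - γ)))) := by
    have h0 := tendsto_pow_atTop_nhds_zero_of_lt_one hγ hγ1
    simp only [pow_add]
    exact (((h0.mul_const _).const_add b).const_mul _).add ((h0.const_mul _).mul_const _)
  have := ge_of_tendsto' ht h
  simpa using this

end BellmanEquation

/-! ### The cover of the cube and nearest neighbour regression -/

section Cover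

variable {d : ℕ}

theorem l2dist_eq_dist (x y : Fin d → ℝ) :
    l2dist x y = dist (WithLp.toLp 2 x) (WithLp.toLp 2 y) := by
  rw [EuclideanSpace.dist_eq]
  simp [l2dist, Real.dist_eq, sq_abs]

theorem l2dist_comm (x y : Fin d → ℝ) : l2dist x y = l2dist y x := by
  rw [l2dist_eq_dist, l2dist_eq_dist, dist_comm]

theorem l2dist_triangle (x y z : Fin d → ℝ) : l2dist x z ≤ l2dist x y + l2dist y z := by
  rw [l2dist_eq_dist, l2dist_eq_dist, l2dist_eq_dist]
  exact dist_triangle _ _ _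

theorem l2dist_nonneg (x y : Fin d → ℝ) : 0 ≤ l2dist x y := Real.sqrt_nonneg _

theorem l2dist_le_of_forall {x y : Fin d → ℝ} {t : ℝ} (ht : 0 ≤ t) (h : ∀ k, |x k - y k| ≤ t) :
    l2dist x y ≤ √(d : ℝ) * t := by
  have h1 : ∑ k, (x k - y k) ^ 2 ≤ d * t ^ 2 := by
    refine (Finset.sum_le_sum fun k _ => (sq_abs (x k - y k)).symm.le.trans
      (pow_le_pow_left₀ (abs_nonneg _) (h k) 2)).trans_eq ?_
    simp
  refine (Real.sqrt_le_sqrt h1).trans_eq ?_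
  rw [Real.sqrt_mul (by positivity), Real.sqrt_sq ht]

theorem measurable_coords : Measurable (coords (d := d)) :=
  measurable_pi_iff.2 fun k => measurable_subtype_coe.comp (measurable_pi_apply k)

theorem measurable_l2dist_coords (c : Fin d → ℝ) :
    Measurable fun s : State d => l2dist c (coords s) := by
  unfold l2dist
  exact (Finset.measurable_sum _ fun k _ => (((measurable_pi_apply k).comp
    measurable_coords).const_sub (c k)).pow_const 2).sqrt

theorem gridMesh_pos {δ : ℝ} (hδ : 0 < δ) : 0 < gridMesh d δ := by
  unfold gridMesh; positivity

theorem gridMesh_le {δ : ℝ} (hδ : 0 < δ) : gridMesh d δ ≤ δ :=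
  div_le_self hδ.le (le_max_left _ _)

theorem sqrt_mul_gridMesh_le {δ : ℝ} (hδ : 0 < δ) : √(d : ℝ) * (gridMesh d δ / 4) ≤ δ := by
  have h : √(d : ℝ) / 4 ≤ max 1 (√(d : ℝ) / 4) := le_max_right _ _
  have h0 : 0 < max 1 (√(d : ℝ) / 4) := lt_max_of_lt_left one_pos
  unfold gridMesh
  rw [div_div, ← mul_div_assoc, div_le_iff₀ (by positivity)]
  nlinarith

theorem l2dist_le_of_forall_le_gridMesh {δ : ℝ} (hδ : 0 < δ) {x y : Fin d → ℝ}
    (h : ∀ k, |x k - y k| ≤ gridMesh d δ / 4) : l2dist x y ≤ δ :=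
  (l2dist_le_of_forall (by linarith [gridMesh_pos (d := d) hδ]) h).trans (sqrt_mul_gridMesh_le hδ)

theorem mem_Icc_of_mem_gridCoords {τ : ℝ} (hτ : 0 < τ) {x : ℝ} (hx : x ∈ gridCoords τ) :
    x ∈ Set.Icc (0 : ℝ) 1 := by
  obtain ⟨i, hi, hx⟩ := hx
  have h1 : (i : ℝ) ≤ 2 / τ := (Nat.le_floor_iff (by positivity)).1 hi
  rw [le_div_iff₀ hτ] at h1
  have h2 : (0 : ℝ) ≤ 1 / 2 * τ * i := by positivity
  rcases hx with rfl | rfl <;> constructor <;> linarith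

/-- Grid points are spaced by `τ / 2`, so rounding costs at most `τ / 4`. When rounding up would
leave the allowed range of `i`, the point is within `τ / 4` of `1`, which the second family supplies
at `i = 0`. -/
theorem exists_gridCoords_abs_sub_le {τ : ℝ} (hτ : 0 < τ) {x : ℝ} (hx : x ∈ Set.Icc (0 : ℝ) 1) :
    ∃ y ∈ gridCoords τ, |y - x| ≤ τ / 4 := by
  set i := ⌊2 * x / τ⌋₊ with hi
  have hx0 : 0 ≤ 2 * x / τ := div_nonneg (by linarith [hx.1]) hτ.le
  have h1 : (i : ℝ) * τ ≤ 2 * x := (le_div_iff₀ hτ).1 (Nat.floor_le hx0)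
  have h2 : 2 * x < (i + 1) * τ := (div_lt_iff₀ hτ).1 (Nat.lt_floor_add_one _)
  have h3 : i ≤ ⌊2 / τ⌋₊ := Nat.floor_le_floor (by
    gcongr
    linarith [hx.2])
  by_cases h4 : 2 * x ≤ i * τ + τ / 2
  · refine ⟨_, ⟨i, h3, Or.inl rfl⟩, ?_⟩
    rw [abs_le]
    constructor <;> linarith
  · by_cases h5 : i + 1 ≤ ⌊2 / τ⌋₊
    · refine ⟨_, ⟨i + 1, h5, Or.inl rfl⟩, ?_⟩
      push_cast
      rw [abs_le]
      constructor <;> linarith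
    · refine ⟨_, ⟨0, Nat.zero_le _, Or.inr rfl⟩, ?_⟩
      have h6 : 2 / τ < i + 1 := by
        have := (Nat.floor_lt (by positivity)).1 (not_le.1 h5)
        exact_mod_cast this
      rw [div_lt_iff₀ hτ] at h6
      rw [abs_le]
      push_cast
      constructor <;> linarith [hx.2]

theorem exists_gridCenters_l2dist_le {δ : ℝ} (hδ : 0 < δ) (s : State d) :
    ∃ c ∈ gridCenters d δ, l2dist c (coords s) ≤ δ := by
  choose c hc hcs using fun k =>
    exists_gridCoords_abs_sub_le (gridMesh_pos (d := d) hδ) (s k).2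
  exact ⟨c, hc, l2dist_le_of_forall_le_gridMesh hδ hcs⟩

/-- A finite set of points that contains the centres. -/
theorem exists_finset_gridCenters {δ : ℝ} (hδ : 0 < δ) (hδ1 : δ < 1) :
    ∃ F : Finset (Fin d → ℝ), ↑F = gridCenters d δ ∧
      (F.card : ℝ) ≤ (6 / gridMesh d δ) ^ d := by
  classical
  set τ := gridMesh d δ with hτd
  have hτ : 0 < τ := gridMesh_pos hδ
  have hτ1 : τ < 1 := (gridMesh_le hδ).trans_lt hδ1
  let G : Finset ℝ := (Finset.range (⌊2 / τ⌋₊ + 1)).image (fun i : ℕ => 1 / 2 * τ * (i : ℝ))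
    ∪ (Finset.range (⌊2 / τ⌋₊ + 1)).image (fun i : ℕ => 1 - 1 / 2 * τ * (i : ℝ))
  have hG : ∀ x, x ∈ G ↔ x ∈ gridCoords τ := by
    intro x
    simp only [G, Finset.mem_union, Finset.mem_image, Finset.mem_range, Nat.lt_succ_iff,
      gridCoords, Set.mem_ofPred_eq]
    constructor
    · rintro (⟨i, hi, rfl⟩ | ⟨i, hi, rfl⟩)
      · exact ⟨i, hi, Or.inl rfl⟩
      · exact ⟨i, hi, Or.inr rfl⟩
    · rintro ⟨i, hi, rfl | rfl⟩
      · exact Or.inl ⟨i, hi, rfl⟩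
      · exact Or.inr ⟨i, hi, rfl⟩
  have hcard : (G.card : ℝ) ≤ 6 / τ := by
    have h1 : G.card ≤ (⌊2 / τ⌋₊ + 1) + (⌊2 / τ⌋₊ + 1) := by
      refine (Finset.card_union_le _ _).trans (add_le_add ?_ ?_) <;>
      exact Finset.card_image_le.trans_eq (Finset.card_range _)
    have h2 : (⌊2 / τ⌋₊ : ℝ) ≤ 2 / τ := Nat.floor_le (by positivity)
    have h3 : (G.card : ℝ) ≤ 2 * ⌊2 / τ⌋₊ + 2 := by
      calc (G.card : ℝ) ≤ ((⌊2 / τ⌋₊ + 1) + (⌊2 / τ⌋₊ + 1) : ℕ) := Nat.cast_le.2 h1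
        _ = _ := by push_cast; ring
    have h4 : 1 ≤ 1 / τ := (one_le_div hτ).2 hτ1.le
    have h5 : 6 / τ = 2 * (2 / τ) + 2 * (1 / τ) := by ring
    linarith
  refine ⟨Fintype.piFinset fun _ => G, ?_, ?_⟩
  · ext c
    simp only [Finset.mem_coe, Fintype.mem_piFinset, hG]
    rfl
  · rw [Fintype.card_piFinset_const]
    push_cast
    exact pow_le_pow_left₀ (by positivity) hcard d

/-- At least one of `[c, c + t]` and `[c - t, c]` lies in the unit interval because `t ≤ 1/2`; this
covers centres on the boundary. -/
theorem ofReal_le_volume_abs_sub_le {c t : ℝ} (hc : c ∈ Set.Icc (0 : ℝ) 1) (ht0 : 0 ≤ t)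
    (ht : t ≤ 1 / 2) :
    ENNReal.ofReal t ≤ volume {x : unitInterval | |c - (x : ℝ)| ≤ t} := by
  have key : ∀ a : ℝ, 0 ≤ a → a + t ≤ 1 → |c - a| ≤ t → |c - (a + t)| ≤ t →
      ENNReal.ofReal t ≤ volume {x : unitInterval | |c - (x : ℝ)| ≤ t} := by
    intro a h0 h1 h2 h3
    rw [unitInterval.volume_apply]
    calc ENNReal.ofReal t = volume (Set.Icc a (a + t)) := by rw [Real.volume_Icc]; simp
      _ ≤ _ := by
        refine measure_mono fun x hx => ⟨⟨x, by linarith [hx.1], by linarith [hx.2]⟩, ?_, rfl⟩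
        simp only [Set.mem_ofPred_eq]
        rw [abs_le] at *
        constructor <;> linarith [hx.1, hx.2]
  by_cases h : c ≤ 1 / 2
  · refine key c hc.1 (by linarith) (by simpa using ht0) ?_
    rw [sub_add_cancel_left, abs_neg, abs_of_nonneg ht0]
  · refine key (c - t) (by linarith) (by linarith [hc.2]) ?_ (by simpa using ht0)
    rw [sub_sub_cancel, abs_of_nonneg ht0]

/-- The ball contains a coordinate cube of half-side `gridMesh d δ / 4`, whose measure factors over
the coordinates. -/
theorem ofReal_le_volume_ball {δ : ℝ} (hδ : 0 < δ) (hδ1 : δ < 1) {c : Fin d → ℝ}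
    (hc : c ∈ gridCenters d δ) :
    ENNReal.ofReal ((gridMesh d δ / 4) ^ d) ≤ volume {s : State d | l2dist c (coords s) ≤ δ} := by
  have hτ : 0 < gridMesh d δ := gridMesh_pos hδ
  have hτ1 : gridMesh d δ < 1 := (gridMesh_le hδ).trans_lt hδ1
  calc ENNReal.ofReal ((gridMesh d δ / 4) ^ d)
      = ∏ _k : Fin d, ENNReal.ofReal (gridMesh d δ / 4) := by
        rw [ENNReal.ofReal_pow (by positivity)]; simp
    _ ≤ ∏ k, volume {x : unitInterval | |c k - (x : ℝ)| ≤ gridMesh d δ / 4} :=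
        Finset.prod_le_prod' fun k _ => ofReal_le_volume_abs_sub_le
          (mem_Icc_of_mem_gridCoords hτ (hc k)) (by positivity) (by linarith)
    _ = volume (Set.univ.pi fun k => {x : unitInterval | |c k - (x : ℝ)| ≤ gridMesh d δ / 4}) :=
        (volume_pi_pi _).symm
    _ ≤ _ := measure_mono fun s hs => l2dist_le_of_forall_le_gridMesh hδ fun k => hs k trivial

/-! ### Size and error of the nearest neighbour estimate -/

variable {m : ℕ} {centers : List (Fin d → ℝ)} {δ : ℝ} {x : Fin m → State d} {y : Fin m → ℝ}

theorem abs_nearestNeighbor_le {b : ℝ} (hb : 0 ≤ b) (hy : ∀ i, |y i| ≤ b) (s : State d) :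
    |nearestNeighbor centers δ x y s| ≤ b := by
  unfold nearestNeighbor
  split
  · simpa using hb
  · dsimp only
    split
    · simpa using hb
    · rw [abs_div, Nat.abs_cast]
      refine div_le_of_le_mul₀ (by positivity) hb ((Finset.abs_sum_le_sum_abs _ _).trans ?_)
      refine (Finset.sum_le_sum fun i _ => hy i).trans_eq ?_
      rw [Finset.sum_const, nsmul_eq_mul, mul_comm]

/-- The error of the regression estimate of a Lipschitz function when every ball contains
samples. -/
theorem abs_nearestNeighbor_sub_le {f : State d → ℝ} {C e : ℝ} (hC : 0 ≤ C)
    (hf : ∀ s s', |f s - f s'| ≤ C * l2dist (coords s) (coords s'))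
    (hcover : ∀ s : State d, ∃ c ∈ centers, l2dist c (coords s) ≤ δ)
    (hx : ∀ c ∈ centers, ∃ i, l2dist c (coords (x i)) ≤ δ)
    (hy : ∀ i, |y i - f (x i)| ≤ e) (s : State d) :
    |nearestNeighbor centers δ x y s - f s| ≤ e + C * (2 * δ) := by
  classical
  unfold nearestNeighbor
  split
  · rename_i h
    obtain ⟨c, hc, hcs⟩ := hcover s
    have := List.find?_eq_none.1 h c hc
    simp [hcs] at this
  · rename_i c h
    have hcs : l2dist c (coords s) ≤ δ := by simpa using List.find?_some h
    obtain ⟨i, hi⟩ := hx c (List.mem_of_find?_eq_some h)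
    dsimp only
    split
    · rename_i hI
      rw [Finset.filter_eq_empty_iff] at hI
      exact absurd hi (hI (Finset.mem_univ i))
    · rename_i hI
      set I := Finset.univ.filter fun i => l2dist c (coords (x i)) ≤ δ
      have hcard : (0 : ℝ) < I.card := by
        exact_mod_cast Finset.card_pos.2 (Finset.nonempty_iff_ne_empty.2 hI)
      have h1 : (∑ i ∈ I, y i) / (I.card : ℝ) - f s = (∑ i ∈ I, (y i - f s)) / I.card := by
        rw [Finset.sum_sub_distrib, Finset.sum_const, nsmul_eq_mul]
        field_simp
      rw [h1, abs_div, Nat.abs_cast, div_le_iff₀ hcard]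
      refine (Finset.abs_sum_le_sum_abs _ _).trans ((Finset.sum_le_sum fun i hi => ?_).trans_eq
        ((Finset.sum_const (e + C * (2 * δ))).trans (by rw [nsmul_eq_mul, mul_comm])))
      have h2 : l2dist c (coords (x i)) ≤ δ := (Finset.mem_filter.1 hi).2
      refine (abs_sub_le _ (f (x i)) _).trans (add_le_add (hy i) ((hf _ _).trans ?_))
      -- The sample and `s` lie in the same ball, so their distance is at most `2 * δ`.
      refine mul_le_mul_of_nonneg_left ((l2dist_triangle _ c _).trans ?_) hC
      rw [l2dist_comm (coords (x i)) c]
      linarith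

end Cover

/-! ### Measurability -/

/-- Used for quantities attached to a random node or a random visit count; only the level sets of
the index need to be measurable, so lists of actions require no σ-algebra. -/
theorem measurable_of_countable_index {Ω ι β : Type*} [MeasurableSpace Ω] [MeasurableSpace β]
    [Countable ι] {X : Ω → ι} (hX : ∀ i, MeasurableSet {ω | X ω = i}) {f : ι → Ω → β}
    (hf : ∀ i, Measurable (f i)) : Measurable fun ω => f (X ω) ω := by
  intro t ht
  have h : (fun ω => f (X ω) ω) ⁻¹' t = ⋃ i, {ω | X ω = i} ∩ f i ⁻¹' t := by
    ext ω; simp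
  rw [h]
  exact MeasurableSet.iUnion fun i => (hX i).inter (hf i ht)

section Search

variable {d : ℕ} {A Ξ Ω : Type*} [Fintype A] [MeasurableSpace A] [DiscreteMeasurableSpace A]
  [MeasurableSpace Ξ] [MeasurableSpace Ω]

theorem DetMDP.measurable_nodeState (M : DetMDP d A Ξ) {s : Ω → State d} (hs : Measurable s)
    (p : List A) : Measurable fun ω => M.nodeState (s ω) p := by
  induction p with
  | nil => exact hs
  | cons a p ih => exact (M.measurable_next a).comp ih

theorem DetMDP.measurable_edgeReward (M : DetMDP d A Ξ) {s : Ω → State d} (hs : Measurable s)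
    {ζ : Ω → Ξ} (hζ : Measurable ζ) (p : List A) :
    Measurable fun ω => M.edgeReward (s ω) (ζ ω) p := by
  cases p with
  | nil => exact measurable_const
  | cons a p => exact (M.measurable_reward a).comp ((M.measurable_nodeState hs p).prodMk hζ)

/-- All statistics of a random search tree are measurable. -/
structure MeasurableTree (T : Ω → SearchTree A) : Prop where
  visits : ∀ p, Measurable fun ω => (T ω).visits p
  edgeValue : ∀ p, Measurable fun ω => (T ω).edgeValue p
  nodeValue : ∀ p, Measurable fun ω => (T ω).nodeValue p

variable {T : Ω → SearchTree A} {M : DetMDP d A Ξ} {γ : ℝ} {P : TreeParams} {tie : TieRule A}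
  {V : Ω → State d → ℝ} {s : Ω → State d} {W : Ω → List A → ℕ → Ξ}

theorem MeasurableTree.cast_visits (hT : MeasurableTree T) (p : List A) :
    Measurable fun ω => ((T ω).visits p : ℝ) :=
  (measurable_of_countable (fun n : ℕ => (n : ℝ))).comp (hT.visits p)

theorem MeasurableTree.index (hT : MeasurableTree T) (p : List A) (a : A) :
    Measurable fun ω => (T ω).index P γ p a := by
  unfold SearchTree.index
  refine Measurable.ite (measurableSet_eq_fun (hT.visits _) measurable_const) measurable_const
    (measurable_coe_real_ereal.comp ?_)
  exact (((hT.edgeValue _).add ((hT.nodeValue _).const_mul γ)).div (hT.cast_visits _)).add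
    ((((hT.cast_visits _).pow_const _).const_mul _).div ((hT.cast_visits _).pow_const _))

/-- The tie rule is arbitrary, but at a fixed node it sees only the visit count and the set of
maximizers, which range over a countable discrete space. -/
theorem MeasurableTree.select (hT : MeasurableTree T) (p : List A) :
    Measurable fun ω => (T ω).select P γ tie p := by
  classical
  let S : Ω → A → Bool := fun ω a =>
    decide (∀ b, (T ω).index P γ p b ≤ (T ω).index P γ p a)
  have hS : Measurable S := measurable_pi_iff.2 fun a => by
    refine measurable_to_bool ?_
    have : (fun ω => S ω a) ⁻¹' {true}
        = ⋂ b, {ω | (T ω).index P γ p b ≤ (T ω).index P γ p a} := by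
      ext ω; simp [S]
    rw [this]
    exact MeasurableSet.iInter fun b => measurableSet_le (hT.index p b) (hT.index p a)
  let g : ℕ × (A → Bool) → A := fun x => tie p x.1 (Finset.univ.filter fun a => x.2 a = true)
  have hg : Measurable g := measurable_of_countable g
  have h : (fun ω => (T ω).select P γ tie p) = fun ω => g ((T ω).visits p, S ω) := by
    ext ω
    simp only [SearchTree.select, g, S, decide_eq_true_eq]
  rw [h]
  exact hg.comp ((hT.visits p).prodMk hS)

theorem MeasurableTree.measurableSet_descend (hT : MeasurableTree T) (h : ℕ) (p : List A) :
    MeasurableSet {ω | (T ω).descend P γ tie h = p} := by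
  induction h generalizing p with
  | zero =>
    simp only [SearchTree.descend]
    exact MeasurableSet.const _
  | succ h ih =>
    cases p with
    | nil => simp [SearchTree.descend]
    | cons a p =>
      have : {ω | (T ω).descend P γ tie (h + 1) = a :: p}
          = {ω | (T ω).descend P γ tie h = p} ∩ (fun ω => (T ω).select P γ tie p) ⁻¹' {a} := by
        ext ω
        simp only [SearchTree.descend, List.cons.injEq, Set.mem_ofPred_eq, Set.mem_inter_iff,
          Set.mem_preimage, Set.mem_singleton_iff]
        constructor
        · rintro ⟨h1, h2⟩
          exact ⟨h2, h2 ▸ h1⟩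
        · rintro ⟨h2, h1⟩
          exact ⟨h2.symm ▸ h1, h2⟩
      rw [this]
      exact (ih p).inter (hT.select p (measurableSet_singleton a))

theorem MeasurableTree.measurableSet_onPath (hT : MeasurableTree T) (p : List A) :
    MeasurableSet {ω | (T ω).OnPath P γ tie p} := by
  have h := hT.measurableSet_descend (P := P) (γ := γ) (tie := tie) p.length p
  have h1 : {ω | (T ω).OnPath P γ tie p}
      = {_ω | p.length ≤ P.depth} ∩ {ω | (T ω).descend P γ tie p.length = p} := by
    ext ω
    exact and_congr Iff.rfl eq_comm
  rw [h1]
  exact (MeasurableSet.const _).inter h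

theorem MeasurableTree.nextReward (hT : MeasurableTree T) (hs : Measurable s)
    (hW : ∀ p j, Measurable fun ω => W ω p j) (h : ℕ) :
    Measurable fun ω => (T ω).nextReward M γ P tie (s ω) (W ω) h := by
  unfold SearchTree.nextReward
  refine measurable_of_countable_index (X := fun ω => (T ω).descend P γ tie h)
    (f := fun p ω => M.edgeReward (s ω) (W ω p ((T ω).visits p)) p)
    (hT.measurableSet_descend h) fun p => ?_
  exact measurable_of_countable_index (X := fun ω => (T ω).visits p)
    (f := fun j ω => M.edgeReward (s ω) (W ω p j) p)
    (fun j => hT.visits p (measurableSet_singleton j))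
    fun j => M.measurable_edgeReward hs (hW p j) p

theorem MeasurableTree.nextReturn (hT : MeasurableTree T) (hs : Measurable s)
    (hW : ∀ p j, Measurable fun ω => W ω p j) (hV : Measurable (Function.uncurry V)) (h : ℕ) :
    Measurable fun ω => (T ω).nextReturn M γ P tie (V ω) (s ω) (W ω) h := by
  unfold SearchTree.nextReturn
  refine (Finset.measurable_sum _ fun i _ => (hT.nextReward hs hW _).const_mul _).add
    (Measurable.const_mul ?_ _)
  exact measurable_of_countable_index (X := fun ω => (T ω).descend P γ tie P.depth)
    (f := fun p ω => V ω (M.nodeState (s ω) p)) (hT.measurableSet_descend P.depth)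
    fun p => hV.comp (measurable_id.prodMk (M.measurable_nodeState hs p))

theorem MeasurableTree.simulate (hT : MeasurableTree T) (hs : Measurable s)
    (hW : ∀ p j, Measurable fun ω => W ω p j) (hV : Measurable (Function.uncurry V)) :
    MeasurableTree fun ω => (T ω).simulate M γ P tie (V ω) (s ω) (W ω) := by
  classical
  have hite : ∀ {β : Type} [MeasurableSpace β] (p : List A) {f g : Ω → β} {F : Ω → β},
      Measurable f → Measurable g → (∀ ω, (T ω).OnPath P γ tie p → F ω = f ω) →
      (∀ ω, ¬ (T ω).OnPath P γ tie p → F ω = g ω) → Measurable F := by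
    intro β _ p f g F hf hg h1 h2
    have : F = fun ω => if (T ω).OnPath P γ tie p then f ω else g ω := by
      ext ω
      split_ifs with h
      · exact h1 ω h
      · exact h2 ω h
    rw [this]
    exact Measurable.ite (hT.measurableSet_onPath p) hf hg
  constructor
  · exact fun p => hite p ((measurable_of_countable (fun n : ℕ => n + 1)).comp (hT.visits p))
      (hT.visits p) (fun ω h => SearchTree.visits_simulate h)
      (fun ω h => SearchTree.visits_simulate' h)
  · exact fun p => hite p ((hT.edgeValue p).add (hT.nextReward hs hW _)) (hT.edgeValue p)
      (fun ω h => SearchTree.edgeValue_simulate h) (fun ω h => SearchTree.edgeValue_simulate' h)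
  · exact fun p => hite p ((hT.nodeValue p).add (hT.nextReturn hs hW hV _)) (hT.nodeValue p)
      (fun ω h => SearchTree.nodeValue_simulate h) (fun ω h => SearchTree.nodeValue_simulate' h)

theorem measurable_mcts (hs : Measurable s) (hW : ∀ p j, Measurable fun ω => W ω p j)
    (hV : Measurable (Function.uncurry V)) :
    Measurable fun ω => mcts M γ P tie (V ω) (s ω) (W ω) := by
  have h : ∀ k, MeasurableTree fun ω =>
      (SearchTree.simulate M γ P tie (V ω) (s ω) (W ω))^[k] (SearchTree.empty A) := by
    intro k
    induction k with
    | zero => constructor <;> intro p <;> exact measurable_const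
    | succ k ih =>
      simp only [Function.iterate_succ_apply']
      exact ih.simulate hs hW hV
  exact ((h P.sims).nodeValue []).div_const _

end Search

/-! ### Measurability of the regression estimate -/

section Regression

variable {d m : ℕ} {Ω : Type*} [MeasurableSpace Ω]

open Classical in
/-- The average of the observations in a ball, and `0` if there are none. -/
def ballAverage (δ : ℝ) (x : Fin m → State d) (y : Fin m → ℝ) : Option (Fin d → ℝ) → ℝ
  | none => 0
  | some c => (∑ i, if l2dist c (coords (x i)) ≤ δ then y i else 0)
      / ∑ i, if l2dist c (coords (x i)) ≤ δ then 1 else 0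

open Classical in
-- Separates the choice of the ball, which depends only on the state, from the average, which
-- depends only on the data.
theorem nearestNeighbor_eq_ballAverage (centers : List (Fin d → ℝ)) (δ : ℝ)
    (x : Fin m → State d) (y : Fin m → ℝ) (s : State d) :
    nearestNeighbor centers δ x y s
      = ballAverage δ x y (centers.find? fun c => decide (l2dist c (coords s) ≤ δ)) := by
  unfold nearestNeighbor
  split
  · rename_i h
    rw [h]
    rfl
  · rename_i c h
    rw [h]
    dsimp only [ballAverage]
    rw [← Finset.sum_filter, ← Finset.sum_filter]
    split_ifs with hI
    · rw [hI]; simp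
    · simp

theorem measurable_ballAverage {δ : ℝ} {x : Ω → Fin m → State d} {y : Ω → Fin m → ℝ}
    (hx : ∀ i, Measurable fun ω => x ω i) (hy : ∀ i, Measurable fun ω => y ω i)
    (o : Option (Fin d → ℝ)) : Measurable fun ω => ballAverage δ (x ω) (y ω) o := by
  classical
  cases o with
  | none => exact measurable_const
  | some c =>
    have h : ∀ i, MeasurableSet {ω | l2dist c (coords (x ω i)) ≤ δ} := fun i =>
      measurableSet_le ((measurable_l2dist_coords c).comp (hx i)) measurable_const
    exact (Finset.measurable_sum _ fun i _ => Measurable.ite (h i) (hy i) measurable_const).div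
      (Finset.measurable_sum _ fun i _ => Measurable.ite (h i) measurable_const measurable_const)

theorem measurable_nearestNeighbor {δ : ℝ} (centers : List (Fin d → ℝ))
    {x : Ω → Fin m → State d} {y : Ω → Fin m → ℝ} (hx : ∀ i, Measurable fun ω => x ω i)
    (hy : ∀ i, Measurable fun ω => y ω i) :
    Measurable (Function.uncurry fun ω s => nearestNeighbor centers δ (x ω) (y ω) s) := by
  classical
  simp only [Function.uncurry_def, nearestNeighbor_eq_ballAverage]
  induction centers with
  | nil => exact measurable_const
  | cons c l ih =>
    have h : MeasurableSet {z : Ω × State d | l2dist c (coords z.2) ≤ δ} :=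
      measurableSet_le ((measurable_l2dist_coords c).comp measurable_snd) measurable_const
    have h1 : (fun z : Ω × State d => ballAverage δ (x z.1) (y z.1)
          ((c :: l).find? fun c => decide (l2dist c (coords z.2) ≤ δ)))
        = fun z => if l2dist c (coords z.2) ≤ δ then ballAverage δ (x z.1) (y z.1) (some c)
          else ballAverage δ (x z.1) (y z.1)
            (l.find? fun c => decide (l2dist c (coords z.2) ≤ δ)) := by
      ext z
      rw [List.find?_cons]
      split_ifs with hz <;> simp [hz]
    rw [h1]
    exact Measurable.ite h ((measurable_ballAverage hx hy (some c)).comp measurable_fst) ih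

/-- The error of the regression estimate in the supremum norm is measurable, whatever the target
function. -/
theorem measurable_iSup_enorm_nearestNeighbor_sub {δ : ℝ} (centers : List (Fin d → ℝ))
    {x : Ω → Fin m → State d} {y : Ω → Fin m → ℝ} (hx : ∀ i, Measurable fun ω => x ω i)
    (hy : ∀ i, Measurable fun ω => y ω i) (f : State d → ℝ) :
    Measurable fun ω => ⨆ s, ‖nearestNeighbor centers δ (x ω) (y ω) s - f s‖ₑ := by
  classical
  -- The first ball containing the state partitions the cube into finitely many cells, and on each
  -- cell the estimate is constant in the state.
  let key : State d → Option (Fin d → ℝ) := fun s =>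
    centers.find? fun c => decide (l2dist c (coords s) ≤ δ)
  have hfin : (Set.range key).Finite := by
    refine ((centers.toFinset.finite_toSet.image some).insert none).subset ?_
    rintro _ ⟨s, rfl⟩
    cases h : key s with
    | none => simp
    | some c => exact Or.inr ⟨c, by simpa using List.mem_of_find?_eq_some h, rfl⟩
  have h1 : ∀ ω, ⨆ s, ‖nearestNeighbor centers δ (x ω) (y ω) s - f s‖ₑ
      = ⨆ o ∈ Set.range key, ⨆ s : {s // key s = o}, ‖ballAverage δ (x ω) (y ω) o - f s‖ₑ := by
    intro ω
    simp only [nearestNeighbor_eq_ballAverage]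
    rw [iSup_range]
    refine le_antisymm (iSup_le fun s => ?_) (iSup_le fun s => iSup_le fun s' => ?_)
    · exact le_iSup_of_le s (le_iSup_of_le ⟨s, rfl⟩ le_rfl)
    · refine le_iSup_of_le s'.1 (le_of_eq ?_)
      have := s'.2
      simp only [key] at this ⊢
      rw [this]
  simp only [h1]
  refine Measurable.biSup _ hfin.countable fun o _ => ?_
  -- On a cell the error is a supremum of continuous functions of the average `v`, hence Borel in
  -- `v` however irregular `f` is.
  have h2 : LowerSemicontinuous fun v : ℝ => ⨆ s : {s // key s = o}, ‖v - f s‖ₑ :=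
    lowerSemicontinuous_iSup fun s =>
      (continuous_enorm.comp (continuous_id.sub continuous_const)).lowerSemicontinuous
  exact h2.measurable.comp (measurable_ballAverage hx hy o)

end Regression

/-! ### Measurability of the estimates of the algorithm -/

section Learning

variable {d : ℕ} {A Ξ : Type*} [Fintype A] [MeasurableSpace A] [DiscreteMeasurableSpace A]
  [MeasurableSpace Ξ] {M : DetMDP d A Ξ} {γ : ℝ} {P : Params} {tie : TieRule A}
  {order : ℝ → List (Fin d → ℝ)}

theorem measurable_seed (l i : ℕ) :
    Measurable fun ω : ℕ → ℕ → Seed d A Ξ => ω l i :=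
  (measurable_pi_apply i).comp (measurable_pi_apply l)

theorem measurable_observation {l i : ℕ} {V : (ℕ → ℕ → Seed d A Ξ) → State d → ℝ}
    (hV : Measurable (Function.uncurry V)) {Q : TreeParams} :
    Measurable fun ω : ℕ → ℕ → Seed d A Ξ => mcts M γ Q tie (V ω) (ω l i).1
      (fun p j => (ω l i).2 (p, j)) :=
  measurable_mcts (measurable_seed l i).fst
    (fun p j => (measurable_pi_apply (p, j)).comp (measurable_seed l i).snd) hV

theorem measurable_valueEstimate (l : ℕ) :
    Measurable (Function.uncurry fun ω => valueEstimate M γ P tie order ω l) := by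
  induction l with
  | zero => exact measurable_const
  | succ l ih =>
    exact measurable_nearestNeighbor _ (fun i => (measurable_seed (l + 1) i).fst)
      fun i => measurable_observation ih

theorem measurable_iSup_enorm_valueEstimate_sub (l : ℕ) (f : State d → ℝ) :
    Measurable fun ω => ⨆ s, ‖valueEstimate M γ P tie order ω l s - f s‖ₑ := by
  cases l with
  | zero =>
    simp only [valueEstimate]
    exact measurable_const
  | succ l =>
    exact measurable_iSup_enorm_nearestNeighbor_sub _ (fun i => (measurable_seed (l + 1) i).fst)
      (fun i => measurable_observation (measurable_valueEstimate l)) f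

end Learning

/-! ### The probability of bad events -/

/-- Two-sided Hoeffding bound for i.i.d. bounded variables, realized on an infinite product. -/
theorem measure_infinitePi_le_abs_sum_le {ι Ξ : Type*} [MeasurableSpace Ξ] (ν : Measure Ξ)
    [IsProbabilityMeasure ν] {f : Ξ → ℝ} (hf : Measurable f) {R : ℝ} (hR : 0 < R)
    (hb : ∀ ζ, |f ζ| ≤ R) {g : ℕ → ι} (hg : g.Injective) {c : ℝ} (hc : 0 ≤ c) {k : ℕ}
    (hk : 1 ≤ k) :
    Measure.infinitePi (fun _ : ι => ν)
        {W | c * √(k : ℝ) ≤ |∑ j ∈ Finset.range k, f (W (g j)) - k * ∫ ζ, f ζ ∂ν|}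
      ≤ ENNReal.ofReal (2 * Real.exp (-(c ^ 2 / (2 * R ^ 2)))) := by
  set μ := Measure.infinitePi (fun _ : ι => ν)
  set e := ∫ ζ, f ζ ∂ν
  have hk0 : (0 : ℝ) < k := by exact_mod_cast hk
  have key : ∀ σ : ℝ, σ = 1 ∨ σ = -1 →
      μ.real {W | c * √(k : ℝ) ≤ ∑ j ∈ Finset.range k, σ * (f (W (g j)) - e)}
        ≤ Real.exp (-(c ^ 2 / (2 * R ^ 2))) := by
    intro σ hσ
    have hindep : iIndepFun (fun j (W : ι → Ξ) => σ * (f (W (g j)) - e)) μ :=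
      (iIndepFun_infinitePi (P := fun _ : ι => ν) (X := fun _ ζ => σ * (f ζ - e))
        fun _ => (hf.sub_const e).const_mul σ).precomp hg
    have hsub : ∀ j < k, HasSubgaussianMGF (fun W : ι → Ξ => σ * (f (W (g j)) - e))
        (R.toNNReal ^ 2) μ := by
      intro j _
      have hme : MeasurePreserving (Function.eval (g j)) μ ν :=
        measurePreserving_eval_infinitePi (fun _ : ι => ν) (g j)
      have h1 := hasSubgaussianMGF_of_mem_Icc (μ := μ) (X := fun W : ι → Ξ => f (W (g j)))
        (a := -R) (b := R) (hf.comp (measurable_pi_apply _)).aemeasurable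
        (Filter.Eventually.of_forall fun W => abs_le.1 (hb _))
      have h2 : ∫ W, f (W (g j)) ∂μ = e := by
        have := integral_map (μ := μ) hme.measurable.aemeasurable (f := f)
          hf.aestronglyMeasurable
        rw [hme.map_eq] at this
        exact this.symm
      -- Hoeffding's lemma on `[-R, R]` has variance proxy `R ^ 2`.
      have h3 : ((‖R - -R‖₊ / 2) ^ 2 : NNReal) = R.toNNReal ^ 2 := by
        ext
        push_cast
        rw [Real.coe_toNNReal R hR.le, Real.norm_of_nonneg (by linarith)]
        ring
      rw [h2, h3] at h1
      rcases hσ with rfl | rfl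
      · simpa using h1
      · have h4 := h1.neg
        refine h4.congr (Filter.Eventually.of_forall fun W => ?_)
        simp
    have h := HasSubgaussianMGF.measure_sum_range_ge_le_of_iIndepFun hindep hsub
      (ε := c * √(k : ℝ)) (by positivity)
    refine h.trans_eq ?_
    congr 1
    rw [mul_pow, Real.sq_sqrt hk0.le]
    push_cast
    rw [Real.coe_toNNReal R hR.le]
    field_simp
  have hsub : {W : ι → Ξ | c * √(k : ℝ) ≤ |∑ j ∈ Finset.range k, f (W (g j)) - k * e|}
      ⊆ {W | c * √(k : ℝ) ≤ ∑ j ∈ Finset.range k, (1 : ℝ) * (f (W (g j)) - e)}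
        ∪ {W | c * √(k : ℝ) ≤ ∑ j ∈ Finset.range k, (-1 : ℝ) * (f (W (g j)) - e)} := by
    intro W hW
    simp only [Set.mem_union, Set.mem_ofPred_eq, ← Finset.mul_sum, Finset.sum_sub_distrib,
      Finset.sum_const, Finset.card_range, nsmul_eq_mul] at hW ⊢
    rcases le_abs.1 hW with h | h
    · left; linarith
    · right; linarith
  refine (measure_mono hsub).trans ((measure_union_le _ _).trans ?_)
  rw [two_mul, ENNReal.ofReal_add (Real.exp_pos _).le (Real.exp_pos _).le]
  refine add_le_add ?_ ?_
  · rw [← ofReal_measureReal]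
    exact ENNReal.ofReal_le_ofReal (key 1 (Or.inl rfl))
  · rw [← ofReal_measureReal]
    exact ENNReal.ofReal_le_ofReal (key (-1) (Or.inr rfl))

section

variable {d : ℕ} {A Ξ : Type*} [Fintype A] [Nonempty A] [MeasurableSpace A]
  [DiscreteMeasurableSpace A] [MeasurableSpace Ξ] (M : DetMDP d A Ξ) {γ R : ℝ}

/-- The seeds with a root at which the rewards do not concentrate. -/
def DetMDP.badSeeds (H n : ℕ) (c : ℝ) : Set (Seed d A Ξ) :=
  {z | ¬ M.Concentrated H n c z.1 fun p j => z.2 (p, j)}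

variable (A) in
/-- The number of nodes of the tree of depth `H`. -/
def numNodes (H : ℕ) : ℕ := (List.finite_length_le A H).toFinset.card

theorem DetMDP.measurable_edgeMean (p : List A) : Measurable fun s => M.edgeMean s p := by
  cases p with
  | nil => exact measurable_const
  | cons a p => exact (M.measurable_meanReward a).comp (M.measurable_nodeState measurable_id p)

/-- For a fixed root state the noise on one edge is i.i.d., so Hoeffding applies on every fibre of
the product, with a bound independent of the root. -/
theorem DetMDP.seedLaw_edge_le (hR : 0 < R) (hM : ∀ s a ζ, |M.reward s a ζ| ≤ R) {c : ℝ}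
    (hc : 0 ≤ c) (p : List A) {k : ℕ} (hk : 1 ≤ k) :
    M.seedLaw {z | c * √(k : ℝ) ≤ |∑ j ∈ Finset.range k, M.edgeReward z.1 (z.2 (p, j)) p
        - k * M.edgeMean z.1 p|}
      ≤ ENNReal.ofReal (2 * Real.exp (-(c ^ 2 / (2 * R ^ 2)))) := by
  have hm : MeasurableSet {z : Seed d A Ξ | c * √(k : ℝ) ≤
      |∑ j ∈ Finset.range k, M.edgeReward z.1 (z.2 (p, j)) p - k * M.edgeMean z.1 p|} := by
    refine measurableSet_le measurable_const (Measurable.norm ((Finset.measurable_sum _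
      fun j _ => M.measurable_edgeReward measurable_fst
        ((measurable_pi_apply (p, j)).comp measurable_snd) p).sub
      (((M.measurable_edgeMean p).comp measurable_fst).const_mul _)))
  unfold DetMDP.seedLaw
  rw [Measure.prod_apply hm]
  refine (lintegral_mono (g := fun _ => ENNReal.ofReal (2 * Real.exp (-(c ^ 2 / (2 * R ^ 2)))))
    fun s => ?_).trans_eq (by simp)
  have h := measure_infinitePi_le_abs_sum_le (ι := List A × ℕ) M.noise
    (f := fun ζ => M.edgeReward s ζ p) (M.measurable_edgeReward measurable_const measurable_id p)
    hR (fun ζ => DetMDP.abs_edgeReward_le hR.le hM ζ) (g := fun j => (p, j))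
    (fun i j h => (Prod.mk.inj h).2) hc hk
  have h1 : ∫ ζ, M.edgeReward s ζ p ∂M.noise = M.edgeMean s p := by
    cases p with
    | nil => simp [DetMDP.edgeReward, DetMDP.edgeMean]
    | cons a p => rfl
  rw [h1] at h
  exact h

theorem DetMDP.seedLaw_badSeeds_le (hR : 0 < R) (hM : ∀ s a ζ, |M.reward s a ζ| ≤ R) {c : ℝ}
    (hc : 0 ≤ c) (H n : ℕ) :
    M.seedLaw (M.badSeeds H n c)
      ≤ ENNReal.ofReal (numNodes A H * n * (2 * Real.exp (-(c ^ 2 / (2 * R ^ 2))))) := by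
  have hsub : M.badSeeds H n c ⊆ ⋃ p ∈ (List.finite_length_le A H).toFinset,
      ⋃ k ∈ Finset.Icc 1 n, {z | c * √(k : ℝ) ≤ |∑ j ∈ Finset.range k,
        M.edgeReward z.1 (z.2 (p, j)) p - k * M.edgeMean z.1 p|} := by
    intro z hz
    simp only [DetMDP.badSeeds, DetMDP.Concentrated, Set.mem_ofPred_eq, not_forall,
      not_le] at hz
    obtain ⟨p, hp, k, hk, h⟩ := hz
    have hk1 : 1 ≤ k := by
      by_contra h0
      obtain rfl : k = 0 := by omega
      simp at h
    simp only [Set.mem_iUnion]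
    refine ⟨p, (List.finite_length_le A H).mem_toFinset.2 hp, k, Finset.mem_Icc.2 ⟨hk1, hk⟩,
      le_trans ?_ h.le⟩
    -- Hoeffding deviations scale like `√k`; the search only needs the weaker exponent `3/4`, and `k
    -- ≥ 1` allows the comparison.
    rw [Real.sqrt_eq_rpow]
    refine mul_le_mul_of_nonneg_left ?_ hc
    exact Real.rpow_le_rpow_of_exponent_le (by exact_mod_cast hk1) (by norm_num)
  refine (measure_mono hsub).trans ((measure_biUnion_finset_le _ _).trans ?_)
  refine (Finset.sum_le_sum fun p _ => (measure_biUnion_finset_le _ _).trans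
    (Finset.sum_le_sum fun k hk => M.seedLaw_edge_le hR hM hc p
      (Finset.mem_Icc.1 hk).1)).trans_eq ?_
  rw [Finset.sum_const, Finset.sum_const, Nat.card_Icc, Nat.add_sub_cancel, nsmul_eq_mul,
    nsmul_eq_mul, mul_assoc, ENNReal.ofReal_mul (Nat.cast_nonneg _),
    ENNReal.ofReal_mul (Nat.cast_nonneg _), ENNReal.ofReal_natCast, ENNReal.ofReal_natCast]
  rfl

theorem DetMDP.sampleLaw_preimage {S : Set (Seed d A Ξ)} (hS : NullMeasurableSet S M.seedLaw)
    (l i : ℕ) : M.sampleLaw {ω | ω l i ∈ S} = M.seedLaw S := by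
  have h : MeasurePreserving (fun ω : ℕ → ℕ → Seed d A Ξ => ω l i) M.sampleLaw M.seedLaw :=
    (measurePreserving_eval_infinitePi (fun _ : ℕ => M.seedLaw) i).comp
      (measurePreserving_eval_infinitePi
        (fun _ : ℕ => Measure.infinitePi fun _ : ℕ => M.seedLaw) l)
  exact h.measure_preimage hS

/-- Passing to a measurable hull makes it unnecessary to prove that the bad seeds form a measurable
set. -/
theorem DetMDP.sampleLaw_preimage_le (S : Set (Seed d A Ξ)) (l i : ℕ) :
    M.sampleLaw {ω | ω l i ∈ S} ≤ M.seedLaw S := by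
  rw [← measure_toMeasurable S, ← M.sampleLaw_preimage
    (measurableSet_toMeasurable _ _).nullMeasurableSet l i]
  exact measure_mono fun ω hω => subset_toMeasurable _ _ hω

instance : IsProbabilityMeasure M.sampleLaw := by
  unfold DetMDP.sampleLaw; infer_instance

/-- The event that none of the first `m` samples of a round lies in a given ball. -/
def missBall (A Ξ : Type*) (c : Fin d → ℝ) (δ : ℝ) (m l : ℕ) : Set (ℕ → ℕ → Seed d A Ξ) :=
  {ω | ∀ i < m, δ < l2dist c (coords (ω l i).1)}

/-- Each independent sample misses the ball with probability at most `1 - v ≤ exp (-v)`, where `v`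
is the lower bound for its volume. -/
theorem DetMDP.sampleLaw_missBall_le {δ : ℝ} (hδ : 0 < δ) (hδ1 : δ < 1) {c : Fin d → ℝ}
    (hc : c ∈ gridCenters d δ) (m l : ℕ) :
    M.sampleLaw (missBall A Ξ c δ m l)
      ≤ ENNReal.ofReal (Real.exp (-(m * (gridMesh d δ / 4) ^ d))) := by
  set v := (gridMesh d δ / 4) ^ d with hv
  let S : Set (Seed d A Ξ) := {z | δ < l2dist c (coords z.1)}
  have hSm : MeasurableSet {s : State d | l2dist c (coords s) ≤ δ} :=
    measurableSet_le (measurable_l2dist_coords c) measurable_const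
  have hS : MeasurableSet S :=
    measurableSet_lt measurable_const ((measurable_l2dist_coords c).comp measurable_fst)
  have hSv : M.seedLaw S ≤ ENNReal.ofReal (Real.exp (-v)) := by
    have h1 : S = {s : State d | l2dist c (coords s) ≤ δ}ᶜ ×ˢ Set.univ := by
      ext z; simp [S]
    unfold DetMDP.seedLaw
    rw [h1, Measure.prod_prod, measure_univ, mul_one, prob_compl_eq_one_sub hSm]
    calc 1 - volume {s : State d | l2dist c (coords s) ≤ δ} ≤ 1 - ENNReal.ofReal v :=
          tsub_le_tsub_left (ofReal_le_volume_ball hδ hδ1 hc) 1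
      _ = ENNReal.ofReal (1 - v) := by
          rw [ENNReal.ofReal_sub _ (by have := gridMesh_pos (d := d) hδ; positivity),
            ENNReal.ofReal_one]
      _ ≤ ENNReal.ofReal (Real.exp (-v)) :=
          ENNReal.ofReal_le_ofReal (by linarith [Real.add_one_le_exp (-v)])
  have h2 : MeasurePreserving (fun ω : ℕ → ℕ → Seed d A Ξ => ω l) M.sampleLaw
      (Measure.infinitePi fun _ : ℕ => M.seedLaw) :=
    measurePreserving_eval_infinitePi
      (fun _ : ℕ => Measure.infinitePi fun _ : ℕ => M.seedLaw) l
  have h3 : missBall A Ξ c δ m l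
      = (fun ω : ℕ → ℕ → Seed d A Ξ => ω l) ⁻¹' Set.pi ↑(Finset.range m) fun _ => S := by
    ext ω
    simp [missBall, S, Set.mem_pi]
  rw [h3, h2.measure_preimage (MeasurableSet.pi (Finset.countable_toSet _)
    fun _ _ => hS).nullMeasurableSet, Measure.infinitePi_pi _ fun _ _ => hS, Finset.prod_const,
    Finset.card_range]
  refine (pow_le_pow_left' hSv m).trans_eq ?_
  rw [← ENNReal.ofReal_pow (Real.exp_pos _).le, ← Real.exp_nat_mul]
  congr 2
  ring

/-- The event that something goes wrong in the first `L` rounds. -/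
def DetMDP.badEvent (L m H n : ℕ) (δ c : ℝ) : Set (ℕ → ℕ → Seed d A Ξ) :=
  ⋃ l ∈ Finset.Icc 1 L, (⋃ i ∈ Finset.range m, {ω | ω l i ∈ M.badSeeds H n c})
    ∪ ⋃ x ∈ gridCenters d δ, missBall A Ξ x δ m l

theorem DetMDP.sampleLaw_badEvent_le (hR : 0 < R) (hM : ∀ s a ζ, |M.reward s a ζ| ≤ R) {c δ : ℝ}
    (hc : 0 ≤ c) (hδ : 0 < δ) (hδ1 : δ < 1) (L m H n : ℕ) :
    M.sampleLaw (M.badEvent L m H n δ c) ≤ ENNReal.ofReal (L *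
      (m * (numNodes A H * n * (2 * Real.exp (-(c ^ 2 / (2 * R ^ 2)))))
        + (6 / gridMesh d δ) ^ d * Real.exp (-(m * (gridMesh d δ / 4) ^ d)))) := by
  obtain ⟨F, hF, hcard⟩ := exists_finset_gridCenters (d := d) hδ hδ1
  have h1 : ∀ l, M.sampleLaw ((⋃ i ∈ Finset.range m, {ω | ω l i ∈ M.badSeeds H n c})
      ∪ ⋃ x ∈ gridCenters d δ, missBall A Ξ x δ m l)
      ≤ ENNReal.ofReal (m * (numNodes A H * n * (2 * Real.exp (-(c ^ 2 / (2 * R ^ 2)))))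
        + (6 / gridMesh d δ) ^ d * Real.exp (-(m * (gridMesh d δ / 4) ^ d))) := by
    intro l
    have hτ := gridMesh_pos (d := d) hδ
    refine (measure_union_le _ _).trans ?_
    rw [ENNReal.ofReal_add (by positivity) (by positivity)]
    refine add_le_add ?_ ?_
    · refine (measure_biUnion_finset_le _ _).trans ((Finset.sum_le_sum fun i _ =>
        (M.sampleLaw_preimage_le _ l i).trans (M.seedLaw_badSeeds_le hR hM hc H n)).trans_eq ?_)
      rw [Finset.sum_const, Finset.card_range, nsmul_eq_mul,
        ENNReal.ofReal_mul (p := (m : ℝ)) (by positivity), ENNReal.ofReal_natCast]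
    · rw [← hF]
      refine (measure_biUnion_finset_le F _).trans ((Finset.sum_le_sum fun x hx =>
        M.sampleLaw_missBall_le hδ hδ1 (hF ▸ Finset.mem_coe.2 hx) m l).trans ?_)
      rw [Finset.sum_const, nsmul_eq_mul, ← ENNReal.ofReal_natCast,
        ← ENNReal.ofReal_mul (by positivity)]
      exact ENNReal.ofReal_le_ofReal (mul_le_mul_of_nonneg_right hcard (Real.exp_pos _).le)
  refine (measure_biUnion_finset_le _ _).trans ((Finset.sum_le_sum fun l _ => h1 l).trans_eq ?_)
  rw [Finset.sum_const, Nat.card_Icc, Nat.add_sub_cancel, nsmul_eq_mul,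
    ENNReal.ofReal_mul (p := (L : ℝ)) (by positivity), ENNReal.ofReal_natCast]

/-! ### The error of the algorithm -/

/-- The same parameters in all rounds. -/
def uniformParams (L m : ℕ) (δ : ℝ) (Q : TreeParams) : Params :=
  ⟨L, fun _ => m, fun _ => δ, fun _ => Q⟩

theorem totalTransitions_uniformParams (L m : ℕ) (δ : ℝ) (Q : TreeParams) (tie : TieRule A)
    (order : ℝ → List (Fin d → ℝ)) (ω : ℕ → ℕ → Seed d A Ξ) :
    totalTransitions M γ (uniformParams L m δ Q) tie order ω = L * (m * (Q.sims * Q.depth)) := by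
  have h : ∀ n : ℕ, ∑ _l ∈ Finset.range L, ∑ _i : Fin m, n = L * (m * n) := fun n => by simp
  simp only [totalTransitions, transitions_searchTree]
  exact h (Q.sims * Q.depth)

variable {M}

theorem abs_valueEstimate_le (hγ : 0 ≤ γ) (hγ1 : γ < 1) (hR : 0 ≤ R)
    (hM : ∀ s a ζ, |M.reward s a ζ| ≤ R) (P : Params) (tie : TieRule A)
    (order : ℝ → List (Fin d → ℝ)) (ω : ℕ → ℕ → Seed d A Ξ) (l : ℕ) (s : State d) :
    |valueEstimate M γ P tie order ω l s| ≤ R / (1 - γ) := by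
  have h0 : 0 ≤ R / (1 - γ) := div_nonneg hR (by linarith)
  induction l generalizing s with
  | zero => simpa [valueEstimate] using h0
  | succ l ih => exact abs_nearestNeighbor_le h0 (fun i => abs_mcts_le hR hγ hγ1 hM ih) s

/-- One good round turns an error `b` into at most `e + b / 2`: `e` collects the search error and
the Lipschitz bias, and the lookahead halves `b`. The bound `R / (1 - γ) / 2 ^ l + 2 * e` satisfies
this recursion with equality, `2 * e` being its fixed point. -/
theorem abs_valueEstimate_sub_le (hγ : 0 ≤ γ) (hγ1 : γ < 1) (hR : 0 ≤ R)
    (hM : ∀ s a ζ, |M.reward s a ζ| ≤ R) {C : ℝ} (hC : 0 ≤ C)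
    (hlip : ∀ s s' : State d, |M.optimalValue γ s - M.optimalValue γ s'|
      ≤ C * l2dist (coords s) (coords s')) {tie : TieRule A} (htie : tie.Valid)
    {order : ℝ → List (Fin d → ℝ)} {δ : ℝ} (hδ : 0 < δ)
    (horder : ∀ c, c ∈ order δ ↔ c ∈ gridCenters d δ) {Q : TreeParams} {c K : ℝ}
    (hc : 2 * (R / (1 - γ)) ≤ c) (hK : 2 * (Fintype.card A : ℝ) + 1 ≤ K)
    (hQ : Q.HasBonus fun h => c * K ^ (Q.depth - h)) (hsims : 1 ≤ Q.sims)
    (hdepth : γ ^ Q.depth ≤ 1 / 2) {L m : ℕ} {ω : ℕ → ℕ → Seed d A Ξ}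
    (hω : ω ∉ M.badEvent L m Q.depth Q.sims δ c) {l : ℕ} (hl : l ≤ L) (s : State d) :
    |valueEstimate M γ (uniformParams L m δ Q) tie order ω l s - M.optimalValue γ s|
      ≤ R / (1 - γ) / 2 ^ l
        + 2 * (c * K ^ Q.depth / (Q.sims : ℝ) ^ (1 / 4 : ℝ) + C * (2 * δ)) := by
  have h0 : 0 ≤ R / (1 - γ) := div_nonneg hR (by linarith)
  have hc0 : 0 ≤ c := by linarith
  have hK0 : 0 ≤ K := by linarith [Nat.cast_nonneg (α := ℝ) (Fintype.card A)]
  have he : 0 ≤ c * K ^ Q.depth / (Q.sims : ℝ) ^ (1 / 4 : ℝ) + C * (2 * δ) := by positivity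
  set e := c * K ^ Q.depth / (Q.sims : ℝ) ^ (1 / 4 : ℝ) + C * (2 * δ) with he_def
  induction l generalizing s with
  | zero =>
    have h1 := M.abs_optimalValue_le hγ hγ1 hR hM s
    simp only [valueEstimate, zero_sub, abs_neg, pow_zero, div_one]
    linarith
  | succ l ih =>
    have hmem : l + 1 ∈ Finset.Icc 1 L := Finset.mem_Icc.2 ⟨by omega, hl⟩
    simp only [DetMDP.badEvent, Set.mem_iUnion, Set.mem_union, not_exists, not_or] at hω
    obtain ⟨hseed, hmiss⟩ := hω (l + 1) hmem
    set b := R / (1 - γ) / 2 ^ l + 2 * e with hb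
    have hb0 : 0 ≤ b := by positivity
    refine (abs_nearestNeighbor_sub_le (C := C)
      (e := c * K ^ Q.depth / (Q.sims : ℝ) ^ (1 / 4 : ℝ) + γ ^ Q.depth * b) hC hlip ?_ ?_ ?_
      s).trans ?_
    · intro s
      obtain ⟨x, hx, hxs⟩ := exists_gridCenters_l2dist_le hδ s
      exact ⟨x, (horder x).2 hx, hxs⟩
    · intro x hx
      have h1 := hmiss x ((horder x).1 hx)
      simp only [missBall, Set.mem_ofPred_eq, not_forall, not_lt] at h1
      obtain ⟨i, hi, h2⟩ := h1
      exact ⟨⟨i, hi⟩, h2⟩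
    · intro i
      have h1 := hseed i (Finset.mem_range.2 i.2)
      simp only [DetMDP.badSeeds, Set.mem_ofPred_eq, not_not] at h1
      have h2 := abs_mcts_sub_le (P := Q) (tie := tie)
        (V := valueEstimate M γ (uniformParams L m δ Q) tie order ω l) hR hM
        (fun s => abs_valueEstimate_le hγ hγ1 hR hM _ tie order ω l s) hγ hγ1 hc hK hQ hsims htie
        h1
      have h3 := M.abs_iterate_bellman_sub_optimalValue_le hγ hγ1 hR hM (ih (by omega)) Q.depth
        (ω (l + 1) i).1
      exact (abs_sub_le _ _ _).trans (add_le_add h2 h3)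
    · have h1 := mul_le_mul_of_nonneg_right hdepth hb0
      have h2 : R / (1 - γ) / 2 ^ (l + 1) = R / (1 - γ) / 2 ^ l / 2 := by
        rw [pow_succ, div_div _ _ (2 : ℝ)]
      change c * K ^ Q.depth / (Q.sims : ℝ) ^ (1 / 4 : ℝ) + γ ^ Q.depth * b + C * (2 * δ) ≤ _
      rw [h2]
      linarith

/-- The expected error in the supremum norm. -/
theorem lintegral_iSup_enorm_valueEstimate_sub_le (hγ : 0 ≤ γ) (hγ1 : γ < 1) (hR : 0 < R)
    (hM : ∀ s a ζ, |M.reward s a ζ| ≤ R) {C : ℝ} (hC : 0 ≤ C)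
    (hlip : ∀ s s' : State d, |M.optimalValue γ s - M.optimalValue γ s'|
      ≤ C * l2dist (coords s) (coords s')) {tie : TieRule A} (htie : tie.Valid)
    {order : ℝ → List (Fin d → ℝ)} {δ : ℝ} (hδ : 0 < δ) (hδ1 : δ < 1)
    (horder : ∀ c, c ∈ order δ ↔ c ∈ gridCenters d δ) {Q : TreeParams} {c K : ℝ}
    (hc : 2 * (R / (1 - γ)) ≤ c) (hK : 2 * (Fintype.card A : ℝ) + 1 ≤ K)
    (hQ : Q.HasBonus fun h => c * K ^ (Q.depth - h)) (hsims : 1 ≤ Q.sims)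
    (hdepth : γ ^ Q.depth ≤ 1 / 2) {L m : ℕ} {ε : ℝ}
    (h1 : R / (1 - γ) / 2 ^ L ≤ ε / 4)
    (h2 : c * K ^ Q.depth / (Q.sims : ℝ) ^ (1 / 4 : ℝ) ≤ ε / 16) (h3 : C * (2 * δ) ≤ ε / 16)
    (h4 : L * (m * (numNodes A Q.depth * Q.sims * (2 * Real.exp (-(c ^ 2 / (2 * R ^ 2)))))
        + (6 / gridMesh d δ) ^ d * Real.exp (-(m * (gridMesh d δ / 4) ^ d)))
      * (2 * (R / (1 - γ))) ≤ ε / 2) (hε : 0 ≤ ε) :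
    ∫⁻ ω, ⨆ s, ‖valueEstimate M γ (uniformParams L m δ Q) tie order ω L s
      - M.optimalValue γ s‖ₑ ∂M.sampleLaw ≤ ENNReal.ofReal ε := by
  have h0 : 0 ≤ R / (1 - γ) := div_nonneg hR.le (by linarith)
  have hc0 : 0 ≤ c := by linarith
  -- Off this hull the pathwise bound holds; on it, where both functions are bounded, the error is
  -- at most `2 * (R / (1 - γ))`.
  set E := toMeasurable M.sampleLaw (M.badEvent L m Q.depth Q.sims δ c) with hE
  have hEm : MeasurableSet E := measurableSet_toMeasurable _ _
  have hbound : ∀ ω, ⨆ s, ‖valueEstimate M γ (uniformParams L m δ Q) tie order ω L s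
      - M.optimalValue γ s‖ₑ
      ≤ ENNReal.ofReal (ε / 2) + E.indicator (fun _ => ENNReal.ofReal (2 * (R / (1 - γ)))) ω := by
    intro ω
    refine iSup_le fun s => ?_
    rw [Real.enorm_eq_ofReal_abs]
    by_cases hω : ω ∈ E
    · rw [Set.indicator_of_mem hω]
      refine le_add_left (ENNReal.ofReal_le_ofReal ((abs_sub _ _).trans ?_))
      have := abs_valueEstimate_le hγ hγ1 hR.le hM (uniformParams L m δ Q) tie order ω L s
      have := M.abs_optimalValue_le hγ hγ1 hR.le hM s
      linarith
    · refine le_add_right (ENNReal.ofReal_le_ofReal ?_)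
      have := abs_valueEstimate_sub_le hγ hγ1 hR.le hM hC hlip htie hδ horder hc hK hQ hsims hdepth
        (fun h => hω (subset_toMeasurable _ _ h)) (le_refl L) s
      linarith
  refine (lintegral_mono hbound).trans ?_
  rw [lintegral_add_left measurable_const, lintegral_indicator_const hEm, lintegral_const,
    measure_univ, mul_one, hE, measure_toMeasurable]
  have h5 := M.sampleLaw_badEvent_le hR hM hc0 hδ hδ1 L m Q.depth Q.sims
  calc _ ≤ ENNReal.ofReal (ε / 2) + ENNReal.ofReal (ε / 2) := by
        refine add_le_add le_rfl ((mul_le_mul_right h5 _).trans ?_)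
        rw [mul_comm, ← ENNReal.ofReal_mul' (by positivity)]
        exact ENNReal.ofReal_le_ofReal h4
    _ = ENNReal.ofReal ε := by
        rw [← ENNReal.ofReal_add (by positivity) (by positivity), add_halves]

end

/-! ### The choice of the parameters -/

/-- Exponents with `ξ⁽ʰ⁾ = ξ⁽ʰ⁺¹⁾ / 4 - 1`. -/
def bonusExponent : ℕ → ℝ
  -- The recursion runs upwards from depth `1`, independently of `H`; this start gives `ξ⁽¹⁾ = 12`
  -- and `α⁽¹⁾ = 3 > 2`.
  | 0 => 2
  | h + 1 => 4 * (bonusExponent h + 1)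

theorem bonusExponent_pos (h : ℕ) : 0 < bonusExponent h := by
  induction h with
  | zero => simp [bonusExponent]
  | succ h ih => simp only [bonusExponent]; linarith

/-- Tree search parameters with `η = 1/2` and the prescribed factors `B h` in the bonus terms. -/
def bonusParams (H n : ℕ) (B : ℕ → ℝ) : TreeParams where
  depth := H
  sims := n
  α h := bonusExponent h / 4
  -- The power `1 / ξ⁽ʰ⁾` in the index undoes this exponent.
  β h := B h ^ bonusExponent h
  ξ := bonusExponent
  η _ := 1 / 2

theorem admissible_bonusParams {H n : ℕ} {B : ℕ → ℝ} (hH : 1 ≤ H) (hn : 1 ≤ n)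
    (hB : ∀ h, 1 < B h) : (bonusParams H n B).Admissible where
  depth_pos := hH
  sims_pos := hn
  eta := ⟨1 / 2, le_rfl, by norm_num, fun _ _ => rfl⟩
  alpha h _ := by simp only [bonusParams]; ring
  xi h _ _ := by simp only [bonusParams, bonusExponent]; ring
  alpha_one := by simp only [bonusParams, bonusExponent]; norm_num
  beta h _ := Real.one_lt_rpow (hB h) (bonusExponent_pos h)

theorem hasBonus_bonusParams {H n : ℕ} {B : ℕ → ℝ} (hB : ∀ h, 1 < B h) :
    (bonusParams H n B).HasBonus B where
  β_rpow h _ := by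
    have h0 := (bonusExponent_pos h).ne'
    simp only [bonusParams]
    rw [← Real.rpow_mul (by linarith [hB h]), mul_one_div_cancel h0, Real.rpow_one]
  α_div h _ := by
    have h0 := (bonusExponent_pos h).ne'
    simp only [bonusParams]
    field_simp
  one_sub_η h _ := by simp only [bonusParams]; norm_num

theorem one_le_log {u : ℝ} (hu : Real.exp 1 ≤ u) : 1 ≤ Real.log u := by
  rw [Real.le_log_iff_exp_le (lt_of_lt_of_le (Real.exp_pos 1) hu)]
  exact hu

/-- For `u ≥ e` and `p ≥ q`, `u ^ q * exp (-(p * log u)) ≤ exp (q - p)`, so one threshold for `p`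
serves all `u`. The factor `p ^ 2 + 1` is there because the number of simulations grows
quadratically with `p`. -/
theorem exists_forall_mul_exp_neg_mul_log_le (κ : ℝ) (q : ℕ) :
    ∃ p₀ : ℝ, ∀ p ≥ p₀, ∀ u ≥ Real.exp 1,
      κ * (p ^ 2 + 1) * u ^ q * Real.exp (-(p * Real.log u)) ≤ 1 / 4 := by
  have h1 := Real.tendsto_pow_mul_exp_neg_atTop_nhds_zero 2
  have h2 := Real.tendsto_pow_mul_exp_neg_atTop_nhds_zero 0
  have h3 : Filter.Tendsto (fun p : ℝ => |κ| * Real.exp q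
      * (p ^ 2 * Real.exp (-p) + p ^ 0 * Real.exp (-p))) Filter.atTop (𝓝 0) := by
    simpa using (h1.add h2).const_mul (|κ| * Real.exp q)
  obtain ⟨p₀, hp₀⟩ := Filter.eventually_atTop.1
    (h3.eventually (ge_mem_nhds (show (0 : ℝ) < 1 / 4 by norm_num)))
  refine ⟨max p₀ q, fun p hp u hu => le_trans ?_ (hp₀ p (le_of_max_le_left hp))⟩
  have hpq : (q : ℝ) ≤ p := le_of_max_le_right hp
  have hu0 : 0 < u := (Real.exp_pos 1).trans_le hu
  have hl := one_le_log hu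
  have h4 : u ^ q * Real.exp (-(p * Real.log u)) ≤ Real.exp q * Real.exp (-p) := by
    rw [← Real.exp_log hu0, ← Real.exp_nat_mul, ← Real.exp_add, ← Real.exp_add, Real.log_exp]
    apply Real.exp_le_exp.2
    nlinarith
  calc κ * (p ^ 2 + 1) * u ^ q * Real.exp (-(p * Real.log u))
      = κ * ((p ^ 2 + 1) * (u ^ q * Real.exp (-(p * Real.log u)))) := by ring
    _ ≤ |κ| * ((p ^ 2 + 1) * (u ^ q * Real.exp (-(p * Real.log u)))) :=
        mul_le_mul_of_nonneg_right (le_abs_self κ) (by positivity)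
    _ ≤ |κ| * ((p ^ 2 + 1) * (Real.exp q * Real.exp (-p))) := by gcongr
    _ = _ := by ring

/-- The requirements on the number `L` of rounds, the number `m` of samples per round, the number
`n` of simulations, the radius `δ` and the factor `c` of the bonus for an error of `1 / u`. -/
structure Suffices (d H N : ℕ) (V R C K u : ℝ) (L m n : ℕ) (δ c : ℝ) : Prop where
  one_le_m : 1 ≤ m
  one_le_n : 1 ≤ n
  δ_pos : 0 < δ
  δ_lt : δ < 1
  one_lt_c : 1 < c
  V_le_c : 2 * V ≤ c
  rounds : V / 2 ^ L ≤ 1 / u / 4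
  search : c * K ^ H / (n : ℝ) ^ (1 / 4 : ℝ) ≤ 1 / u / 16
  radius : C * (2 * δ) ≤ 1 / u / 16
  prob : L * (m * (N * n * (2 * Real.exp (-(c ^ 2 / (2 * R ^ 2)))))
      + (6 / gridMesh d δ) ^ d * Real.exp (-(m * (gridMesh d δ / 4) ^ d))) * (2 * V) ≤ 1 / u / 2

/-- With `j = ⌈log u⌉` one has `u ≤ e ^ j`, so it is enough that `2 ^ a` exceeds `4 * (V + 1) * e`;
`a ≥ 1` serves the lower bound on the number of rounds. -/
theorem exists_rounds {V : ℝ} (hV : 0 ≤ V) :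
    ∃ a : ℕ, 1 ≤ a ∧ ∀ u ≥ Real.exp 1, V / 2 ^ (a * ⌈Real.log u⌉₊) ≤ 1 / u / 4 := by
  obtain ⟨a, ha⟩ := pow_unbounded_of_one_lt (4 * (V + 1) * Real.exp 1) (one_lt_two (α := ℝ))
  have he : 1 ≤ Real.exp 1 := Real.one_le_exp zero_le_one
  refine ⟨a, ?_, fun u hu => ?_⟩
  · by_contra h
    obtain rfl : a = 0 := by omega
    nlinarith
  · have hu0 : 0 < u := (Real.exp_pos 1).trans_le hu
    have hl := one_le_log hu
    set j := ⌈Real.log u⌉₊ with hj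
    have hj1 : j ≠ 0 := (Nat.ceil_pos.2 (by linarith)).ne'
    have h1 : u ≤ Real.exp 1 ^ j := by
      rw [← Real.exp_nat_mul, mul_one]
      calc u = Real.exp (Real.log u) := (Real.exp_log hu0).symm
        _ ≤ _ := Real.exp_le_exp.2 (Nat.le_ceil _)
    have h2 : 4 * V * u ≤ 2 ^ (a * j) := by
      calc 4 * V * u ≤ (4 * (V + 1)) ^ j * Real.exp 1 ^ j := by
            gcongr
            calc 4 * V ≤ 4 * (V + 1) := by linarith
              _ ≤ _ := le_self_pow₀ (by linarith) hj1
        _ = (4 * (V + 1) * Real.exp 1) ^ j := (mul_pow _ _ _).symm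
        _ ≤ (2 ^ a) ^ j := by gcongr
        _ = 2 ^ (a * j) := (pow_mul _ _ _).symm
    rw [div_div, div_le_div_iff₀ (by positivity) (by positivity)]
    linarith

theorem natCeil_le_add_one_mul {x y z : ℝ} (hx : 0 ≤ x) (hz : 1 ≤ z) (hxy : x = y * z) :
    (⌈x⌉₊ : ℝ) ≤ (y + 1) * z := by
  have := Nat.ceil_lt_add_one hx
  rw [add_mul, one_mul, ← hxy]
  linarith

/-- Collects the powers of `u`: degree `1` from the rounds, `1 + d` from the samples, `6` from the
simulations and `1` from the target accuracy. -/
theorem concentration_term_le {L m n N V E u a₁ a₂ a₃ w : ℝ} {d : ℕ} (hm0 : 0 ≤ m)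
    (hn0 : 0 ≤ n) (hN : 0 ≤ N) (hV : 0 ≤ V) (hE : 0 ≤ E) (hu : 0 ≤ u) (ha₁ : 0 ≤ a₁)
    (ha₂ : 0 ≤ a₂) (hL : L ≤ a₁ * u) (hm : m ≤ a₂ * u ^ (1 + d)) (hn : n ≤ a₃ * w * u ^ 6) :
    L * (m * (N * n * (2 * E))) * (2 * V) * u
      ≤ a₁ * a₂ * a₃ * N * 4 * V * w * u ^ (1 + (1 + d) + 6 + 1) * E := by
  calc _ ≤ (a₁ * u) * (a₂ * u ^ (1 + d) * (N * (a₃ * w * u ^ 6) * (2 * E))) * (2 * V) * u := by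
        gcongr
    _ = _ := by ring

theorem cover_term_le {L V E E' u a₁ b : ℝ} {d : ℕ} (hV : 0 ≤ V) (hE : 0 ≤ E) (hu : 0 ≤ u)
    (ha₁ : 0 ≤ a₁) (hb : 0 ≤ b) (hL : L ≤ a₁ * u) (hE' : E ≤ E') :
    L * ((b * u) ^ d * E) * (2 * V) * u ≤ a₁ * b ^ d * (2 * V) * u ^ (1 + d + 1) * E' := by
  calc _ ≤ (a₁ * u) * ((b * u) ^ d * E') * (2 * V) * u := by gcongr
    _ = _ := by rw [mul_pow]; ring

-- Write `l = log u`. The choice `δ = 1 / (b * u)` with `b = 32 * C + 2` makes the bias at most `1 /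
-- (16 * u)` and `δ < 1`. The choice `c = R * √(2 * p' * l)` makes the Hoeffding factor `u ^ (-p')`.
-- Then `n` is `(16 * K ^ H * u * c) ^ 4` rounded up, as the search accuracy demands. Since `4 * b'
-- * u` is the reciprocal of a quarter of the mesh, `m` makes the probability of missing a given
-- ball at most `u ^ (-q')`. The threshold for `q'` is fixed before that for `p'`, because the union
-- bound over the samples involves `q'` through `Y`.
set_option maxHeartbeats 1000000 in
theorem exists_suffices (d H N : ℕ) {V R C K : ℝ} (hV : 0 ≤ V) (hR : 0 < R) (hC : 0 ≤ C)
    (hK : 1 ≤ K) :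
    ∃ (κ : ℝ) (L m n : ℝ → ℕ) (δ c : ℝ → ℝ), ∀ u ≥ Real.exp 1,
      Suffices d H N V R C K u (L u) (m u) (n u) (δ u) (c u) ∧
      Real.log u ≤ L u ∧ (L u : ℝ) ≤ κ * Real.log u ∧
      (L u : ℝ) * (m u * n u) ≤ κ * (u ^ (4 + d) * Real.log u ^ 5) := by
  obtain ⟨a, ha1, ha⟩ := exists_rounds hV
  set D : ℝ := max 1 (√(d : ℝ) / 4) with hD
  have hD1 : 1 ≤ D := le_max_left _ _
  set b : ℝ := 32 * C + 2 with hb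
  have hb2 : 2 ≤ b := by linarith
  set b' : ℝ := b * D with hb'
  have hb'1 : 1 ≤ b' := one_le_mul_of_one_le_of_one_le (by linarith) hD1
  obtain ⟨q, hq⟩ := exists_forall_mul_exp_neg_mul_log_le
    (2 * a * (6 * b') ^ d * (2 * V)) (1 + d + 1)
  set q' : ℝ := max q 1 with hq'
  have hq'1 : 1 ≤ q' := le_max_right _ _
  set Y : ℝ := q' * (4 * b') ^ d with hY
  have hY0 : 0 ≤ Y := by positivity
  set X : ℝ := (16 * K ^ H) ^ 4 * (4 * R ^ 4) with hX
  have hX0 : 0 < X := by positivity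
  obtain ⟨p, hp⟩ := exists_forall_mul_exp_neg_mul_log_le
    (2 * a * (Y + 1) * (X + 1) * N * 4 * V) (1 + (1 + d) + 6 + 1)
  -- The last entry forces `c ≥ 2 * V + 2`, hence both `c > 1` and `2 * V ≤ c`.
  set p' : ℝ := max p (max 1 (((2 * V + 2) / R) ^ 2)) with hp'
  have hp'1 : 1 ≤ p' := (le_max_left _ _).trans (le_max_right _ _)
  have hp'2 : ((2 * V + 2) / R) ^ 2 ≤ p' := (le_max_right _ _).trans (le_max_right _ _)
  refine ⟨2 * a + 2 * a * (Y + 1) * (X * p' ^ 2 + 1), fun u => a * ⌈Real.log u⌉₊,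
    fun u => ⌈q' * Real.log u * (4 * b' * u) ^ d⌉₊,
    fun u => ⌈(16 * K ^ H * u) ^ 4 * (4 * R ^ 4) * (p' * Real.log u) ^ 2⌉₊,
    fun u => 1 / (b * u), fun u => R * √(2 * p' * Real.log u), fun u hu => ?_⟩
  have hu0 : 0 < u := (Real.exp_pos 1).trans_le hu
  have hu1 : 1 ≤ u := (Real.one_le_exp zero_le_one).trans hu
  have hl := one_le_log hu
  have hlu : Real.log u ≤ u := (Real.log_le_sub_one_of_pos hu0).trans (by linarith)
  set l := Real.log u with hl_def
  have hl0 : 0 ≤ l := by linarith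
  set L : ℕ := a * ⌈l⌉₊ with hL
  set m : ℕ := ⌈q' * l * (4 * b' * u) ^ d⌉₊ with hm
  set n : ℕ := ⌈(16 * K ^ H * u) ^ 4 * (4 * R ^ 4) * (p' * l) ^ 2⌉₊ with hn
  have ha1' : (1 : ℝ) ≤ a := by exact_mod_cast ha1
  have hL1 : l ≤ L := by
    rw [hL]; push_cast
    have := Nat.le_ceil l
    nlinarith
  have hL2 : (L : ℝ) ≤ 2 * a * l := by
    rw [hL]; push_cast
    have := Nat.ceil_lt_add_one hl0
    nlinarith
  have hm2 : (m : ℝ) ≤ (Y + 1) * (l * u ^ d) :=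
    natCeil_le_add_one_mul (by positivity) (one_le_mul_of_one_le_of_one_le hl (one_le_pow₀ hu1))
      (by rw [hY, mul_pow (4 * b')]; ring)
  have hn2 : (n : ℝ) ≤ (X * p' ^ 2 + 1) * (u ^ 4 * l ^ 2) :=
    natCeil_le_add_one_mul (by positivity)
      (one_le_mul_of_one_le_of_one_le (one_le_pow₀ hu1) (one_le_pow₀ hl))
      (by rw [hX]; ring)
  have hτ : gridMesh d (1 / (b * u)) = 1 / (b' * u) := by
    rw [gridMesh, ← hD, hb', div_div]
    congr 1
    ring
  have hbu : 2 ≤ b * u := by nlinarith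
  refine ⟨⟨?_, ?_, by positivity, ?_, ?_, ?_, ha u hu, ?_, ?_, ?_⟩, hL1, ?_, ?_⟩
  · exact Nat.ceil_pos.2 (by positivity)
  · exact Nat.ceil_pos.2 (by positivity)
  · rw [div_lt_one (by positivity)]; linarith
  · have h1 : (2 * V + 2) / R ≤ √(2 * p' * l) := Real.le_sqrt_of_sq_le (by nlinarith)
    rw [div_le_iff₀ hR] at h1
    linarith
  · have h1 : (2 * V + 2) / R ≤ √(2 * p' * l) := Real.le_sqrt_of_sq_le (by nlinarith)
    rw [div_le_iff₀ hR] at h1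
    linarith
  · have hn0 : (0 : ℝ) < n := by exact_mod_cast Nat.ceil_pos.2 (by positivity)
    have h1 : (16 * K ^ H * u * (R * √(2 * p' * l))) ^ 4 ≤ n := by
      refine le_trans (le_of_eq ?_) (Nat.le_ceil _)
      rw [mul_pow, mul_pow R, show √(2 * p' * l) ^ 4 = (√(2 * p' * l) ^ 2) ^ 2 by ring,
        Real.sq_sqrt (by positivity)]
      ring
    have h2 : 16 * K ^ H * u * (R * √(2 * p' * l)) ≤ (n : ℝ) ^ (1 / 4 : ℝ) := by
      refine le_of_pow_le_pow_left₀ (n := 4) (by norm_num) (by positivity) (h1.trans_eq ?_)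
      rw [← Real.rpow_natCast, ← Real.rpow_mul hn0.le]
      norm_num
    rw [div_div, div_le_div_iff₀ (by positivity) (by positivity)]
    linarith
  · have h1 : 2 * C / b ≤ 1 / 16 := by
      rw [div_le_div_iff₀ (by linarith) (by norm_num)]; linarith
    calc C * (2 * (1 / (b * u))) = 2 * C / b * (1 / u) := by
          rw [div_mul_div_comm]; ring
      _ ≤ 1 / 16 * (1 / u) := mul_le_mul_of_nonneg_right h1 (by positivity)
      _ = 1 / u / 16 := by ring
  · have hc : (R * √(2 * p' * l)) ^ 2 / (2 * R ^ 2) = p' * l := by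
      rw [mul_pow, Real.sq_sqrt (by positivity)]
      field_simp
    have h1 : Real.exp (-(m * (gridMesh d (1 / (b * u)) / 4) ^ d)) ≤ Real.exp (-(q' * l)) := by
      apply Real.exp_le_exp.2 (neg_le_neg _)
      have h2 : q' * l * (4 * b' * u) ^ d ≤ m := Nat.le_ceil _
      calc q' * l = q' * l * (4 * b' * u) ^ d * (gridMesh d (1 / (b * u)) / 4) ^ d := by
            rw [mul_assoc, ← mul_pow, hτ]
            have : 4 * b' * u * (1 / (b' * u) / 4) = 1 := by field_simp
            rw [this, one_pow, mul_one]
        _ ≤ _ := by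
            gcongr
            rw [hτ]; positivity
    have h6 : 6 / gridMesh d (1 / (b * u)) = 6 * b' * u := by
      rw [hτ]; field_simp
    have e1 := hp p' (le_max_left _ _) u hu
    have e2 := hq q' (le_max_left _ _) u hu
    rw [← hl_def] at e1 e2
    rw [hc, h6, div_div, le_div_iff₀ (by positivity)]
    have hL3 : (L : ℝ) ≤ 2 * a * u := hL2.trans (by gcongr)
    have hm3 : (m : ℝ) ≤ (Y + 1) * u ^ (1 + d) := hm2.trans (by
      rw [pow_add, pow_one]; gcongr)
    have hn3 : (n : ℝ) ≤ (X + 1) * (p' ^ 2 + 1) * u ^ 6 := by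
      refine hn2.trans ?_
      have h7 : u ^ 4 * l ^ 2 ≤ u ^ 6 := by
        calc u ^ 4 * l ^ 2 ≤ u ^ 4 * u ^ 2 := by gcongr
          _ = u ^ 6 := by ring
      have h8 : X * p' ^ 2 + 1 ≤ (X + 1) * (p' ^ 2 + 1) := by nlinarith [sq_nonneg p']
      gcongr
    have t1 : (L : ℝ) * (m * (N * n * (2 * Real.exp (-(p' * l))))) * (2 * V) * u ≤ 1 / 4 := by
      refine (concentration_term_le (Nat.cast_nonneg m) (Nat.cast_nonneg n) (Nat.cast_nonneg N)
        hV (Real.exp_pos _).le hu0.le (by positivity) (by positivity) hL3 hm3 hn3).trans e1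
    have t2 : (L : ℝ) * ((6 * b' * u) ^ d
        * Real.exp (-(m * (gridMesh d (1 / (b * u)) / 4) ^ d))) * (2 * V) * u ≤ 1 / 4 := by
      refine (cover_term_le hV (Real.exp_pos _).le hu0.le (by positivity) (by positivity) hL3
        h1).trans (le_trans ?_ e2)
      have h9 : 2 * a * (6 * b') ^ d * (2 * V)
          ≤ 2 * a * (6 * b') ^ d * (2 * V) * (q' ^ 2 + 1) :=
        le_mul_of_one_le_right (by positivity) (by linarith [sq_nonneg q'])
      exact mul_le_mul_of_nonneg_right (mul_le_mul_of_nonneg_right h9 (by positivity))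
        (Real.exp_pos _).le
    linarith
  · refine hL2.trans (mul_le_mul_of_nonneg_right ?_ hl0)
    have : 0 ≤ 2 * a * (Y + 1) * (X * p' ^ 2 + 1) := by positivity
    linarith
  · calc (L : ℝ) * (m * n)
        ≤ (2 * a * l) * ((Y + 1) * (l * u ^ d) * ((X * p' ^ 2 + 1) * (u ^ 4 * l ^ 2))) := by
          gcongr
      _ = 2 * a * (Y + 1) * (X * p' ^ 2 + 1) * (u ^ (4 + d) * l ^ 4) := by ring
      _ ≤ (2 * a + 2 * a * (Y + 1) * (X * p' ^ 2 + 1)) * (u ^ (4 + d) * l ^ 5) := by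
          -- Rounds, samples and simulations contribute `l`, `l` and `l ^ 2`; the fifth power is
          -- slack.
          have : l ^ 4 ≤ l ^ 5 := pow_le_pow_right₀ hl (by norm_num)
          gcongr
          linarith

end MctsNN

end

/-! ### Assembly: from the accuracy parameter `u` to `ε` -/

theorem theorem2 {A : Type*} [Fintype A] [Nonempty A] [MeasurableSpace A]
    [DiscreteMeasurableSpace A] (d : ℕ) (γ R C : ℝ) (hγ0 : 0 < γ) (hγ1 : γ < 1) (hR : 0 < R) :
    ∃ (P : ℝ → MctsNN.Params) (T : ℝ → ℝ),
      (fun ε => ((P ε).rounds : ℝ)) =Θ[𝓝[>] (0 : ℝ)] (fun ε => Real.log (ε / (R / (1 - γ)))) ∧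
      T =O[𝓝[>] (0 : ℝ)] (fun ε => ε ^ (-(4 + (d : ℤ))) * Real.log (1 / ε) ^ 5) ∧
      ∀ ε : ℝ, 0 < ε →
        (P ε).Admissible ∧
        ∀ {Ξ : Type*} [MeasurableSpace Ξ] (M : MctsNN.DetMDP d A Ξ),
          (∀ s a ζ, |M.reward s a ζ| ≤ R) →
          (∀ s s' : MctsNN.State d, |M.optimalValue γ s - M.optimalValue γ s'|
            ≤ C * MctsNN.l2dist (MctsNN.coords s) (MctsNN.coords s')) →
          ∀ tie : MctsNN.TieRule A, tie.Valid →
          ∀ order : ℝ → List (Fin d → ℝ),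
            (∀ δ : ℝ, 0 < δ → δ < 1 → ∀ c, c ∈ order δ ↔ c ∈ MctsNN.gridCenters d δ) →
            AEMeasurable (fun ω => ⨆ s, ‖MctsNN.valueEstimate M γ (P ε) tie order ω (P ε).rounds s
                - M.optimalValue γ s‖ₑ) M.sampleLaw ∧
            ∫⁻ ω, ⨆ s, ‖MctsNN.valueEstimate M γ (P ε) tie order ω (P ε).rounds s
                - M.optimalValue γ s‖ₑ ∂M.sampleLaw ≤ ENNReal.ofReal ε ∧
            ∀ ω, (MctsNN.totalTransitions M γ (P ε) tie order ω : ℝ) ≤ T ε := by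
  -- The depth is `H + 1`, so that it is positive.
  obtain ⟨H, hH⟩ : ∃ H : ℕ, γ ^ (H + 1) ≤ 1 / 2 := by
    obtain ⟨H, hH⟩ := exists_pow_lt_of_lt_one (show (0 : ℝ) < 1 / 2 by norm_num) hγ1
    exact ⟨H, (pow_le_pow_of_le_one hγ0.le hγ1.le (Nat.le_succ H)).trans hH.le⟩
  have hV : 0 < R / (1 - γ) := div_pos hR (by linarith)
  set V : ℝ := R / (1 - γ) with hV_def
  set K : ℝ := 2 * (Fintype.card A : ℝ) + 1 with hK_def
  have hK : 1 ≤ K := by linarith [Nat.cast_nonneg (α := ℝ) (Fintype.card A)]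
  -- `C` may be negative; `|C|` is then still a Lipschitz constant.
  obtain ⟨κ, L, m, n, δ, c, hsuff⟩ := MctsNN.exists_suffices d (H + 1)
    (MctsNN.numNodes A (H + 1)) (C := |C|) hV.le hR (abs_nonneg C) hK
  -- The cut-off at `e` keeps `log u ≥ 1` for large `ε` and is inactive as `ε → 0`.
  let U : ℝ → ℝ := fun ε => max (1 / ε) (Real.exp 1)
  let Q : ℝ → MctsNN.TreeParams := fun u =>
    MctsNN.bonusParams (H + 1) (n u) fun h => c u * K ^ (H + 1 - h)
  have hU : ∀ ε, Real.exp 1 ≤ U ε := fun ε => le_max_right _ _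
  have hU_eq : ∀ᶠ ε in 𝓝[>] (0 : ℝ), 0 < ε ∧ U ε = 1 / ε := by
    have h1 : Set.Ioo (0 : ℝ) (1 / Real.exp 1) ∈ 𝓝[>] (0 : ℝ) :=
      Ioo_mem_nhdsGT (by positivity)
    filter_upwards [h1] with ε hε
    refine ⟨hε.1, max_eq_left ?_⟩
    rw [le_div_iff₀ hε.1]
    have := (lt_div_iff₀ (Real.exp_pos 1)).1 hε.2
    linarith
  -- From here on `log (1 / ε)` and `|log (ε / V)|` agree up to a factor `2`.
  have hlog : ∀ᶠ ε in 𝓝[>] (0 : ℝ), 2 * |Real.log V| ≤ Real.log (1 / ε) := by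
    have h1 : Filter.Tendsto (fun ε : ℝ => Real.log (1 / ε)) (𝓝[>] (0 : ℝ)) Filter.atTop := by
      simp only [one_div]
      exact Real.tendsto_log_atTop.comp tendsto_inv_nhdsGT_zero
    exact h1.eventually_ge_atTop _
  refine ⟨fun ε => MctsNN.uniformParams (L (U ε)) (m (U ε)) (δ (U ε)) (Q (U ε)),
    fun ε => L (U ε) * (m (U ε) * (n (U ε) * (H + 1 : ℕ))), ⟨?_, ?_⟩, ?_, ?_⟩
  · refine IsBigO.of_bound (2 * |κ|) ?_
    filter_upwards [hU_eq, hlog] with ε hε hε2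
    obtain ⟨-, -, h2, -⟩ := hsuff (U ε) (hU ε)
    have h0 : 0 ≤ Real.log (1 / ε) := le_trans (by positivity) hε2
    rw [hε.2] at h2
    rw [Real.log_div hε.1.ne' hV.ne', Real.norm_eq_abs, Real.norm_eq_abs]
    simp only [MctsNN.uniformParams]
    rw [hε.2, Nat.abs_cast]
    have h3 : Real.log (1 / ε) ≤ 2 * |Real.log ε - Real.log V| := by
      rw [one_div, Real.log_inv] at hε2 ⊢
      have h4 := neg_le_abs (Real.log ε - Real.log V)
      have h5 := neg_abs_le (Real.log V)
      linarith
    calc (L (1 / ε) : ℝ) ≤ κ * Real.log (1 / ε) := h2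
      _ ≤ |κ| * Real.log (1 / ε) := mul_le_mul_of_nonneg_right (le_abs_self κ) h0
      _ ≤ |κ| * (2 * |Real.log ε - Real.log V|) := mul_le_mul_of_nonneg_left h3 (abs_nonneg κ)
      _ = _ := by ring
  · refine IsBigO.of_bound 2 ?_
    filter_upwards [hU_eq, hlog] with ε hε hε2
    obtain ⟨-, h1, -, -⟩ := hsuff (U ε) (hU ε)
    have h0 : 0 ≤ Real.log (1 / ε) := le_trans (by positivity) hε2
    rw [hε.2] at h1
    rw [Real.log_div hε.1.ne' hV.ne', Real.norm_eq_abs, Real.norm_eq_abs]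
    simp only [MctsNN.uniformParams]
    rw [hε.2, Nat.abs_cast]
    rw [one_div, Real.log_inv] at hε2 h0
    have h3 : Real.log (1 / ε) = -Real.log ε := by rw [one_div, Real.log_inv]
    rw [h3] at h1
    have h4 : |Real.log ε - Real.log V| ≤ -Real.log ε + |Real.log V| := by
      refine (abs_sub _ _).trans ?_
      rw [abs_of_nonpos (by linarith)]
    have h5 := abs_nonneg (Real.log V)
    linarith
  · refine IsBigO.of_bound (κ * (H + 1 : ℕ)) ?_
    filter_upwards [hU_eq] with ε hε
    obtain ⟨-, -, -, h1⟩ := hsuff (U ε) (hU ε)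
    have h2 := MctsNN.one_le_log (hU ε)
    rw [hε.2] at h1 h2 ⊢
    have hε0 := hε.1
    have h3 : ε ^ (-(4 + (d : ℤ))) = (1 / ε) ^ (4 + d) := by
      rw [zpow_neg, one_div, inv_pow]
      congr 1
    rw [h3, Real.norm_of_nonneg (by positivity), Real.norm_of_nonneg (by positivity)]
    calc _ = (L (1 / ε) : ℝ) * (m (1 / ε) * n (1 / ε)) * (H + 1 : ℕ) := by ring
      _ ≤ κ * ((1 / ε) ^ (4 + d) * Real.log (1 / ε) ^ 5) * (H + 1 : ℕ) := by gcongr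
      _ = _ := by ring
  · intro ε hε
    obtain ⟨h, -, -, -⟩ := hsuff (U ε) (hU ε)
    have hUε : 1 / U ε ≤ ε := by
      rw [div_le_iff₀ ((Real.exp_pos 1).trans_le (hU ε))]
      have := mul_le_mul_of_nonneg_left (le_max_left (1 / ε) (Real.exp 1)) hε.le
      rwa [mul_one_div_cancel hε.ne'] at this
    have hB : ∀ k, 1 < c (U ε) * K ^ (H + 1 - k) := fun k =>
      one_lt_mul_of_lt_of_le h.one_lt_c (one_le_pow₀ hK)
    refine ⟨fun l _ => ⟨h.one_le_m, h.δ_pos, h.δ_lt,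
      MctsNN.admissible_bonusParams (Nat.succ_pos H) h.one_le_n hB⟩, ?_⟩
    intro Ξ _ M hM hlip tie htie order horder
    refine ⟨(MctsNN.measurable_iSup_enorm_valueEstimate_sub _ _).aemeasurable, ?_, fun ω => ?_⟩
    · refine (MctsNN.lintegral_iSup_enorm_valueEstimate_sub_le (K := K) hγ0.le hγ1 hR hM
        (abs_nonneg C) (fun s s' => (hlip s s').trans (mul_le_mul_of_nonneg_right (le_abs_self C)
          (MctsNN.l2dist_nonneg _ _))) htie h.δ_pos h.δ_lt (horder _ h.δ_pos h.δ_lt) h.V_le_c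
        le_rfl (MctsNN.hasBonus_bonusParams hB) h.one_le_n hH h.rounds h.search h.radius h.prob
        (by have := hU ε; have := Real.exp_pos 1; positivity)).trans
        (ENNReal.ofReal_le_ofReal hUε)
    · rw [MctsNN.totalTransitions_uniformParams]
      simp [Q, MctsNN.bonusParams]
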